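/- **Setting.** All algebras are complex and unital, and all homomorphisms are unital. A *graded-differential \*-algebra* is an $\mathbb N$-graded algebra with a differential $d$ of degree $1$ satisfying $d(xy)=d(x)y+(-1)^{\partial x}x\,d(y)$, and an antilinear degree-preserving involution with $(xy)^*=(-1)^{\partial x\,\partial y}y^*x^*$ and $d(x^*)=d(x)^*$. $\widehat\otimes$ is the graded tensor product, with differential $d\otimes\mathrm{id}+(-1)^{\partial}\otimes d$ and involution $*\otimes *$. Let $\mathcal A$ be the Hopf \*-algebra of polynomial functions on a compact matrix quantum group $G$ (generated by the matrix entries of a finite-dimensional unitary corepresentation), with coproduct $\phi$. Let $\Gamma$ be a bicovariant first-order \*-calculus over $G$, $\Gamma_{inv}\subseteq\Gamma$ the space of left-invariant elements, and $\varpi:\Gamma_{inv}\to\Gamma_{inv}\otimes\mathcal A$ the restriction of the right coaction of $\Gamma$. Let $\Gamma^\star$ be either the universal differential envelope $\Gamma^\wedge$ of $\Gamma$ or, more generally, any quotient of $\Gamma^\wedge$ by a graded-differential \*-ideal which is trivial in degrees $0$ and $1$ (for example the braided exterior algebra $\Gamma^\vee$). Let $P=(\mathcal B,i,F)$ be a quantum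 principal $G$-bundle over a quantum space $M$ represented by a \*-algebra $\mathcal V$: $F:\mathcal B\to\mathcal B\otimes\mathcal A$ is a coaction by \*-homomorphisms, $i:\mathcal V\to\mathcal B$ is an injective \*-homomorphism onto $\{b: F(b)=b\otimes 1\}$, and each $1\otimes a$ is a sum of elements $(q\otimes 1)F(b)$. Let $\Omega(P)$ be a calculus on $P$: a graded-differential \*-algebra with $\Omega^0(P)=\mathcal B$, generated by $\mathcal B$ as a differential algebra, such that $F$ extends to a homomorphism $\widehat F:\Omega(P)\to\Omega(P)\mathbin{\widehat\otimes}\Gamma^\star$ of graded-differential \*-algebras. Put $\Omega(M)=\{w\in\Omega(P):\widehat F(w)=w\otimes1\}$ and let $H(M)$ be its cohomology algebra. A *connection* is a hermitian linear map $\omega:\Gamma_{inv}\to\Omega^1(P)$ with $$\widehat F\omega(\vartheta)=(\omega\otimes\mathrm{id})\varpi(\vartheta)+1\otimes\vartheta,\qquad \vartheta\in\Gamma_{inv}.$$ Let $\Omega$ be the universal differential envelope of the tensor algebra $\Gamma_{inv}^{\otimes}$, that is, the differential algebra generated by $\Gamma_{inv}$ (in degree $1$) with the only relation $d(1)=0$,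 with the \*-structure extending that of $\Gamma_{inv}$. Let $\widetilde\varpi:\Omega\to\Omega\mathbin{\widehat\otimes}\Gamma^\star$ be the graded-differential homomorphism with $\widetilde\varpi(\vartheta)=\varpi(\vartheta)+1\otimes\vartheta$, let $\daleth=\{w\in\Omega:\widetilde\varpi(w)=w\otimes1\}$, a graded-differential subalgebra, and let $H(\daleth)$ be its cohomology algebra. **Proposition.** (i) For each connection $\omega$ there exists a unique homomorphism $\widehat\omega:\Omega\to\Omega(P)$ of differential algebras with $\widehat\omega(\vartheta)=\omega(\vartheta)$ for each $\vartheta\in\Gamma_{inv}$. It preserves the grading, it is hermitian, and $\widehat F\,\widehat\omega=(\widehat\omega\otimes\mathrm{id})\widetilde\varpi$. In particular $\widehat\omega(\daleth)\subseteq\Omega(M)$. (ii) The induced homomorphism $W:H(\daleth)\to H(M)$ of cohomology algebras does not depend on $\omega$. More precisely, for any two connections $\omega,\tau$ there is a unique linear map $L:\Omega\to\Omega(P)$ with $$L(1)=0,\quad L(\vartheta)=0,\quad L(d\vartheta)=\omega(\vartheta)-\tau(\vartheta),\quad L(wu)=L(w)\widehat\tau(u)+(-1)^{\partial w}\widehat\omega(w)L(u)$$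 for $\vartheta\in\Gamma_{inv}$, homogeneous $w\in\Omega$ and $u\in\Omega$; it satisfies $$\widehat\omega-\widehat\tau=Ld+dL,\qquad \widehat F L=(L\otimes\mathrm{id})\widetilde\varpi,\qquad L(\daleth)\subseteq\Omega(M).$$ -/

import Mathlib

open scoped TensorProduct DirectSum

universe u v w

noncomputable section

namespace QPB

/-! ### Graded-differential *-algebras -/

/-- A graded-differential *-algebra over `ℂ`: a unital `ℕ`-graded algebra with a differential `d` of
degree one satisfying the graded Leibniz rule, and an antilinear, degree preserving, graded
antimultiplicative involution `st` commuting with `d`. -/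
structure GDSAlg where
  carrier : Type u
  [ring : Ring carrier]
  [algebra : Algebra ℂ carrier]
  gr : ℕ → Submodule ℂ carrier
  [graded : GradedAlgebra gr]
  d : carrier →ₗ[ℂ] carrier
  st : carrier →ₛₗ[starRingEnd ℂ] carrier
  d_mem : ∀ n, ∀ x ∈ gr n, d x ∈ gr (n + 1)
  d_d : ∀ x, d (d x) = 0
  d_mul : ∀ n, ∀ x ∈ gr n, ∀ y, d (x * y) = d x * y + (-1 : ℂ) ^ n • (x * d y)
  st_mem : ∀ n, ∀ x ∈ gr n, st x ∈ gr n
  st_st : ∀ x, st (st x) = x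
  st_mul : ∀ m n, ∀ x ∈ gr m, ∀ y ∈ gr n, st (x * y) = (-1 : ℂ) ^ (m * n) • (st y * st x)
  st_d : ∀ x, st (d x) = d (st x)

instance : CoeSort GDSAlg.{u} (Type u) := ⟨GDSAlg.carrier⟩
attribute [instance] GDSAlg.ring GDSAlg.algebra GDSAlg.graded

section Grading

variable {A : Type*} [Ring A] [Algebra ℂ A] (gr : ℕ → Submodule ℂ A) [GradedAlgebra gr]

/-- The linear operator multiplying elements of degree `n` by the scalar `f n`. -/
def gradeScale (f : ℕ → ℂ) : A →ₗ[ℂ] A :=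
  DirectSum.toModule ℂ ℕ A (fun n => f n • (gr n).subtype) ∘ₗ
    (DirectSum.decomposeLinearEquiv gr).toLinearMap

theorem gradeScale_apply (f : ℕ → ℂ) {n : ℕ} {x : A} (hx : x ∈ gr n) :
    gradeScale gr f x = f n • x := by
  simp only [gradeScale, LinearMap.comp_apply, LinearEquiv.coe_coe,
    DirectSum.decomposeLinearEquiv_apply]
  rw [DirectSum.decompose_of_mem gr hx, ← DirectSum.lof_eq_of ℂ, DirectSum.toModule_lof]
  simp

/-- To prove a property of all elements, it suffices to treat homogeneous ones. -/
theorem hom_induction {p : A → Prop} (h : ∀ n, ∀ x ∈ gr n, p x)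
    (hadd : ∀ x y, p x → p y → p (x + y)) (x : A) : p x :=
  DirectSum.Decomposition.inductionOn gr (h 0 0 (zero_mem _)) (fun {i} m => h i m m.2) hadd x

theorem proj_of_mem {n : ℕ} {x : A} (hx : x ∈ gr n) (m : ℕ) :
    GradedAlgebra.proj gr m x = if m = n then x else 0 := by
  rw [GradedAlgebra.proj_apply]
  split_ifs with h
  · subst h; exact DirectSum.decompose_of_mem_same gr hx
  · exact DirectSum.decompose_of_mem_ne gr hx (Ne.symm h)

theorem proj_mem (m : ℕ) (x : A) : GradedAlgebra.proj gr m x ∈ gr m := by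
  rw [GradedAlgebra.proj_apply]; exact SetLike.coe_mem _

theorem sum_proj (x : A) : ∃ N, x = ∑ n ∈ Finset.range N, GradedAlgebra.proj gr n x := by
  classical
  refine ⟨((DirectSum.decompose gr x).support.sup id) + 1, ?_⟩
  conv_lhs => rw [← DirectSum.sum_support_decompose gr x]
  refine Finset.sum_subset ?_ ?_
  · intro i hi
    exact Finset.mem_range.2 (Nat.lt_succ_of_le (Finset.le_sup (f := id) hi))
  · intro i _ hi
    simpa using hi

end Grading

namespace GDSAlg

variable (A : GDSAlg.{u}) (B : GDSAlg.{v}) (C : GDSAlg.{w})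

/-- The parity operator `x ↦ (-1)^∂x x`. -/
def parity : A →ₗ[ℂ] A := gradeScale A.gr (fun n => (-1) ^ n)

/-- The projection onto the component of degree `n`. -/
abbrev proj (n : ℕ) : A →ₗ[ℂ] A := GradedAlgebra.proj A.gr n

variable {A} in
theorem parity_apply {n : ℕ} {x : A} (hx : x ∈ A.gr n) : A.parity x = (-1 : ℂ) ^ n • x :=
  gradeScale_apply _ _ hx

theorem leibniz (x y : A) : A.d (x * y) = A.d x * y + A.parity x * A.d y := by
  refine hom_induction A.gr (p := fun x => A.d (x * y) = A.d x * y + A.parity x * A.d y) ?_ ?_ x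
  · intro n x hx
    rw [A.d_mul n x hx, parity_apply hx, smul_mul_assoc]
  · intro x x' h h'
    simp only [add_mul, map_add, h, h']; abel

theorem one_mem : (1 : A) ∈ A.gr 0 := SetLike.GradedOne.one_mem

theorem parity_one : A.parity 1 = 1 := by simp [parity_apply A.one_mem]

theorem d_one : A.d 1 = 0 := by
  have := A.leibniz 1 1
  simpa [parity_one] using this

theorem parity_parity (x : A) : A.parity (A.parity x) = x := by
  refine hom_induction A.gr (p := fun x => A.parity (A.parity x) = x) ?_ ?_ x
  · intro n x hx
    rw [parity_apply hx, map_smul, parity_apply hx, smul_smul, ← mul_pow]; simp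
  · intro x y h h'; simp [h, h']

theorem parity_mul (x y : A) : A.parity (x * y) = A.parity x * A.parity y := by
  refine hom_induction A.gr (p := fun x => A.parity (x * y) = A.parity x * A.parity y) ?_ ?_ x
  · intro n x hx
    refine hom_induction A.gr (p := fun y => A.parity (x * y) = A.parity x * A.parity y) ?_ ?_ y
    · intro m y hy
      rw [parity_apply hx, parity_apply hy, parity_apply (SetLike.GradedMul.mul_mem hx hy),
        smul_mul_smul_comm, pow_add]
    · intro y y' h h'; simp [mul_add, h, h']
  · intro x x' h h'; simp [add_mul, h, h']

theorem d_parity (x : A) : A.d (A.parity x) = - A.parity (A.d x) := by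
  refine hom_induction A.gr (p := fun x => A.d (A.parity x) = - A.parity (A.d x)) ?_ ?_ x
  · intro n x hx
    rw [parity_apply hx, parity_apply (A.d_mem n x hx), map_smul, pow_succ]; simp
  · intro x y h h'; simp only [map_add, h, h']; abel

/-! ### The graded tensor product -/

/-- The differential `d ⊗ id + (-1)^∂ ⊗ d` of the graded tensor product. -/
def tensorD : A.gr ᵍ⊗[ℂ] B.gr →ₗ[ℂ] A.gr ᵍ⊗[ℂ] B.gr :=
  (GradedTensorProduct.of ℂ A.gr B.gr).toLinearMap ∘ₗ
    (TensorProduct.map A.d LinearMap.id + TensorProduct.map A.parity B.d) ∘ₗ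
      (GradedTensorProduct.of ℂ A.gr B.gr).symm.toLinearMap

/-- The *-structure `* ⊗ *` of the graded tensor product. -/
def tensorSt (x : A.gr ᵍ⊗[ℂ] B.gr) : A.gr ᵍ⊗[ℂ] B.gr :=
  GradedTensorProduct.of ℂ A.gr B.gr
    (TensorProduct.map A.st B.st ((GradedTensorProduct.of ℂ A.gr B.gr).symm x))

/-- The elements of total degree `n` in the graded tensor product. -/
def tensorGr (n : ℕ) : Submodule ℂ (A.gr ᵍ⊗[ℂ] B.gr) :=
  Submodule.span ℂ {t | ∃ i j, i + j = n ∧ ∃ a ∈ A.gr i, ∃ b ∈ B.gr j, t = a ᵍ⊗ₜ[ℂ] b}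

variable {A B} in
/-- The linear map `f ⊗ id`. -/
def tensorMapLeft (f : A →ₗ[ℂ] B) : A.gr ᵍ⊗[ℂ] C.gr →ₗ[ℂ] B.gr ᵍ⊗[ℂ] C.gr :=
  (GradedTensorProduct.of ℂ B.gr C.gr).toLinearMap ∘ₗ
    TensorProduct.map f LinearMap.id ∘ₗ (GradedTensorProduct.of ℂ A.gr C.gr).symm.toLinearMap

variable {A B}

theorem tensorD_tmul (a : A) (b : B) :
    tensorD A B (a ᵍ⊗ₜ[ℂ] b) = (A.d a) ᵍ⊗ₜ[ℂ] b + (A.parity a) ᵍ⊗ₜ[ℂ] (B.d b) := by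
  simp [tensorD]

theorem tensor_induction {p : A.gr ᵍ⊗[ℂ] B.gr → Prop}
    (h : ∀ i j, ∀ a ∈ A.gr i, ∀ b ∈ B.gr j, p (a ᵍ⊗ₜ[ℂ] b))
    (hadd : ∀ x y, p x → p y → p (x + y)) (x : A.gr ᵍ⊗[ℂ] B.gr) : p x := by
  have key : ∀ t : A ⊗[ℂ] B, p (GradedTensorProduct.of ℂ A.gr B.gr t) := by
    intro t
    induction t using TensorProduct.induction_on with
    | zero => simpa [GradedTensorProduct.tmul] using h 0 0 0 (zero_mem _) 0 (zero_mem _)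
    | add x y hx hy => rw [map_add]; exact hadd _ _ hx hy
    | tmul a b =>
      refine hom_induction A.gr (p := fun a => p (a ᵍ⊗ₜ[ℂ] b)) ?_ ?_ a
      · intro i a ha
        refine hom_induction B.gr (p := fun b => p (a ᵍ⊗ₜ[ℂ] b)) ?_ ?_ b
        · intro j b hb; exact h i j a ha b hb
        · intro x y hx hy
          rw [GradedTensorProduct.tmul, TensorProduct.tmul_add, map_add]; exact hadd _ _ hx hy
      · intro x y hx hy
        rw [GradedTensorProduct.tmul, TensorProduct.add_tmul, map_add]; exact hadd _ _ hx hy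
  exact key ((GradedTensorProduct.of ℂ A.gr B.gr).symm x)

theorem tmul_mul_tmul {i j : ℕ} (a : A) {b : B} (hb : b ∈ B.gr j) {a' : A} (ha' : a' ∈ A.gr i)
    (b' : B) : (a ᵍ⊗ₜ[ℂ] b * a' ᵍ⊗ₜ[ℂ] b' : A.gr ᵍ⊗[ℂ] B.gr) =
      (-1 : ℂ) ^ (j * i) • ((a * a') ᵍ⊗ₜ[ℂ] (b * b')) := by
  have := GradedTensorProduct.tmul_coe_mul_coe_tmul (R := ℂ) A.gr B.gr a ⟨b, hb⟩ ⟨a', ha'⟩ b'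
  rw [this]
  rcases Nat.even_or_odd (j * i) with h | h
  · have h1 : ((-1 : ℤˣ) ^ (j * i)) = 1 := h.neg_one_pow
    simp [h1, h.neg_one_pow]
  · have h1 : ((-1 : ℤˣ) ^ (j * i)) = -1 := h.neg_one_pow
    simp [h1, h.neg_one_pow, Units.smul_def]

theorem tensorGr_mul {m n : ℕ} {x y : A.gr ᵍ⊗[ℂ] B.gr} (hx : x ∈ tensorGr A B m)
    (hy : y ∈ tensorGr A B n) : x * y ∈ tensorGr A B (m + n) := by
  have : tensorGr A B m * tensorGr A B n ≤ tensorGr A B (m + n) := by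
    rw [tensorGr, tensorGr, Submodule.span_mul_span, Submodule.span_le]
    rintro _ ⟨_, ⟨i, j, rfl, a, ha, b, hb, rfl⟩, _, ⟨i', j', rfl, a', ha', b', hb', rfl⟩, rfl⟩
    change (_ * _ : A.gr ᵍ⊗[ℂ] B.gr) ∈ tensorGr A B _
    rw [tmul_mul_tmul a hb ha' b']
    refine Submodule.smul_mem _ _ (Submodule.subset_span ?_)
    exact ⟨i + i', j + j', by omega, _, SetLike.GradedMul.mul_mem ha ha', _,
      SetLike.GradedMul.mul_mem hb hb', rfl⟩
  exact this (Submodule.mul_mem_mul hx hy)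

theorem tmul_mem {i j : ℕ} {a : A} (ha : a ∈ A.gr i) {b : B} (hb : b ∈ B.gr j) :
    (a ᵍ⊗ₜ[ℂ] b : A.gr ᵍ⊗[ℂ] B.gr) ∈ tensorGr A B (i + j) :=
  Submodule.subset_span ⟨i, j, rfl, a, ha, b, hb, rfl⟩

theorem tensorD_mem {n : ℕ} {x : A.gr ᵍ⊗[ℂ] B.gr} (hx : x ∈ tensorGr A B n) :
    tensorD A B x ∈ tensorGr A B (n + 1) := by
  have : tensorGr A B n ≤ (tensorGr A B (n + 1)).comap (tensorD A B) := by
    refine Submodule.span_le.2 ?_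
    rintro _ ⟨i, j, rfl, a, ha, b, hb, rfl⟩
    change tensorD A B _ ∈ tensorGr A B _
    rw [tensorD_tmul, parity_apply ha]
    refine add_mem ?_ ?_
    · have := tmul_mem (A.d_mem i a ha) hb
      rwa [show i + 1 + j = i + j + 1 by omega] at this
    · have := tmul_mem (Submodule.smul_mem (A.gr i) ((-1 : ℂ) ^ i) ha) (B.d_mem j b hb)
      rwa [← add_assoc] at this
  exact this hx

theorem tensorD_tensorD (x : A.gr ᵍ⊗[ℂ] B.gr) : tensorD A B (tensorD A B x) = 0 := by
  refine tensor_induction (p := fun x => tensorD A B (tensorD A B x) = 0) ?_ ?_ x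
  · intro i j a ha b hb
    simp only [tensorD_tmul, map_add, A.d_d, B.d_d, A.d_parity]
    simp [GradedTensorProduct.tmul, TensorProduct.neg_tmul]
  · intro x y hx hy; simp [hx, hy]

theorem tensorD_mul {n : ℕ} {x : A.gr ᵍ⊗[ℂ] B.gr} (hx : x ∈ tensorGr A B n)
    (y : A.gr ᵍ⊗[ℂ] B.gr) :
    tensorD A B (x * y) = tensorD A B x * y + (-1 : ℂ) ^ n • (x * tensorD A B y) := by
  induction hx using Submodule.span_induction with
  | zero => simp
  | add x x' _ _ h h' => simp only [add_mul, map_add, smul_add, h, h']; abel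
  | smul c x _ h => simp only [smul_mul_assoc, map_smul, h, smul_add]; rw [smul_comm]
  | mem x hx =>
    obtain ⟨i, j, rfl, a, ha, b, hb, rfl⟩ := hx
    refine tensor_induction (p := fun y => tensorD A B (a ᵍ⊗ₜ[ℂ] b * y) =
      tensorD A B (a ᵍ⊗ₜ[ℂ] b) * y + (-1 : ℂ) ^ (i + j) • (a ᵍ⊗ₜ[ℂ] b * tensorD A B y)) ?_ ?_ y
    · intro i' j' a' ha' b' hb'
      have hpa := Submodule.smul_mem (A.gr i) ((-1 : ℂ) ^ i) ha
      have hpa' := Submodule.smul_mem (A.gr i') ((-1 : ℂ) ^ i') ha'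
      rw [tmul_mul_tmul a hb ha' b', map_smul, tensorD_tmul, tensorD_tmul, tensorD_tmul,
        parity_apply ha, parity_apply ha', parity_apply (SetLike.GradedMul.mul_mem ha ha'),
        add_mul, mul_add, tmul_mul_tmul _ hb ha', tmul_mul_tmul _ (B.d_mem j b hb) ha',
        tmul_mul_tmul _ hb (A.d_mem i' a' ha'), tmul_mul_tmul _ hb hpa',
        A.d_mul i a ha, B.d_mul j b hb]
      simp only [GradedTensorProduct.tmul, TensorProduct.add_tmul, TensorProduct.tmul_add, map_add,
        smul_mul_assoc, mul_smul_comm, ← TensorProduct.smul_tmul', TensorProduct.tmul_smul, map_smul,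
        smul_add, smul_smul]
      have e1 : (-1 : ℂ) ^ (j * i') * (-1) ^ i = (-1) ^ (i + j) * (-1) ^ (j * (i' + 1)) := by
        have : (-1 : ℂ) ^ (j + j) = 1 := (Even.add_self j).neg_one_pow
        rw [← pow_add, ← pow_add, show i + j + j * (i' + 1) = (j * i' + i) + (j + j) by ring,
          pow_add _ _ (j + j), this, mul_one]
      have e2 : (-1 : ℂ) ^ (j * i') * (-1) ^ (i + i') = (-1) ^ ((j + 1) * i') * (-1) ^ i := by
        rw [← pow_add, ← pow_add]; congr 1; ring
      have e3 : (-1 : ℂ) ^ (j * i') * ((-1) ^ j * (-1) ^ (i + i')) =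
          (-1) ^ (i + j) * ((-1) ^ (j * i') * (-1) ^ i') := by
        simp only [← pow_add]; congr 1; ring
      rw [e1, e2, e3]; abel
    · intro x y hx hy
      simp only [mul_add, map_add, hx, hy, smul_add]; abel

end GDSAlg

/-! ### Homomorphisms, coactions, invariants, cohomology -/

/-- A (unital) homomorphism of differential algebras. -/
structure DGHom (A : GDSAlg.{u}) (B : GDSAlg.{v}) where
  toAlgHom : A →ₐ[ℂ] B
  map_d : ∀ x, toAlgHom (A.d x) = B.d (toAlgHom x)

instance (A : GDSAlg.{u}) (B : GDSAlg.{v}) : CoeFun (DGHom A B) (fun _ => A → B) :=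
  ⟨fun f => f.toAlgHom⟩

/-- A graded-differential homomorphism `A → A ⊗̂ C` into the graded tensor product. -/
structure DGCoaction (A : GDSAlg.{u}) (C : GDSAlg.{v}) where
  toAlgHom : A →ₐ[ℂ] A.gr ᵍ⊗[ℂ] C.gr
  map_mem : ∀ n, ∀ x ∈ A.gr n, toAlgHom x ∈ GDSAlg.tensorGr A C n
  map_d : ∀ x, toAlgHom (A.d x) = GDSAlg.tensorD A C (toAlgHom x)

instance (A : GDSAlg.{u}) (C : GDSAlg.{v}) :
    CoeFun (DGCoaction A C) (fun _ => A → A.gr ᵍ⊗[ℂ] C.gr) :=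
  ⟨fun f => f.toAlgHom⟩

/-- A graded-differential subalgebra. -/
structure DGSub (A : GDSAlg.{u}) where
  toSubalgebra : Subalgebra ℂ A
  proj_mem : ∀ n, ∀ x ∈ toSubalgebra, A.proj n x ∈ toSubalgebra
  d_mem : ∀ x ∈ toSubalgebra, A.d x ∈ toSubalgebra

instance (A : GDSAlg.{u}) : Membership A (DGSub A) := ⟨fun K x => x ∈ K.toSubalgebra⟩

namespace DGCoaction

variable {A : GDSAlg.{u}} {C : GDSAlg.{v}} (Φ : DGCoaction A C)

/-- The projection of the graded tensor product onto total degree `n`. -/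
def totalProj (A : GDSAlg.{u}) (C : GDSAlg.{v}) (n : ℕ) :
    A.gr ᵍ⊗[ℂ] C.gr →ₗ[ℂ] A.gr ᵍ⊗[ℂ] C.gr :=
  (GradedTensorProduct.of ℂ A.gr C.gr).toLinearMap ∘ₗ
    (∑ p ∈ Finset.HasAntidiagonal.antidiagonal n, TensorProduct.map (A.proj p.1) (C.proj p.2)) ∘ₗ
      (GradedTensorProduct.of ℂ A.gr C.gr).symm.toLinearMap

theorem totalProj_apply {n m : ℕ} {x : A.gr ᵍ⊗[ℂ] C.gr}
    (hx : x ∈ GDSAlg.tensorGr A C m) : totalProj A C n x = if n = m then x else 0 := by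
  induction hx using Submodule.span_induction with
  | zero => simp
  | add x y _ _ h h' => rw [map_add, h, h']; split_ifs <;> simp
  | smul c x _ h => rw [map_smul, h]; split_ifs <;> simp
  | mem x hx =>
    obtain ⟨i, j, rfl, a, ha, c, hc, rfl⟩ := hx
    have : totalProj A C n (a ᵍ⊗ₜ[ℂ] c) = ∑ p ∈ Finset.HasAntidiagonal.antidiagonal n,
        ((A.proj p.1 a) ᵍ⊗ₜ[ℂ] (C.proj p.2 c) : A.gr ᵍ⊗[ℂ] C.gr) := by
      simp [totalProj]
    rw [this]
    split_ifs with h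
    · subst h
      rw [Finset.sum_eq_single (i, j)]
      · simp only [proj_of_mem _ ha, proj_of_mem _ hc, if_true]
      · rintro ⟨p, q⟩ _ hpq
        simp only [proj_of_mem _ ha, proj_of_mem _ hc]
        by_cases hp : p = i
        · have hq : q ≠ j := fun hq => hpq (by rw [hp, hq])
          simp [hq, GradedTensorProduct.tmul]
        · simp [hp, GradedTensorProduct.tmul]
      · intro h; simp at h
    · refine Finset.sum_eq_zero ?_
      rintro ⟨p, q⟩ hpq
      have hpq' := Finset.HasAntidiagonal.mem_antidiagonal.1 hpq
      simp only [proj_of_mem _ ha, proj_of_mem _ hc]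
      by_cases hp : p = i
      · have hq : q ≠ j := fun hq => h (by rw [← hpq', ← hp, ← hq])
        simp [hq, GradedTensorProduct.tmul]
      · simp [hp, GradedTensorProduct.tmul]

theorem map_proj (n : ℕ) (x : A) : Φ (A.proj n x) = totalProj A C n (Φ x) := by
  refine hom_induction A.gr (p := fun x => Φ (A.proj n x) = totalProj A C n (Φ x)) ?_ ?_ x
  · intro m x hx
    rw [totalProj_apply (Φ.map_mem m x hx), proj_of_mem _ hx]
    split_ifs <;> simp
  · intro x y h h'; simp only [map_add, h, h']

/-- The graded-differential subalgebra of invariant elements, `Φ w = w ⊗ 1`. -/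
def invariants : DGSub A where
  toSubalgebra := AlgHom.equalizer Φ.toAlgHom (GradedTensorProduct.includeLeft A.gr C.gr)
  proj_mem := by
    intro n x hx
    have hx' : Φ x = x ᵍ⊗ₜ[ℂ] 1 := hx
    change Φ (A.proj n x) = (A.proj n x) ᵍ⊗ₜ[ℂ] (1 : C)
    rw [map_proj, hx']
    refine hom_induction A.gr
      (p := fun x => totalProj A C n (x ᵍ⊗ₜ[ℂ] (1 : C)) = (A.proj n x) ᵍ⊗ₜ[ℂ] (1 : C)) ?_ ?_ x
    · intro m x hx
      rw [totalProj_apply (by simpa using GDSAlg.tmul_mem hx C.one_mem), proj_of_mem _ hx]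
      split_ifs <;> simp [GradedTensorProduct.tmul]
    · intro x y h h'
      simp only [GradedTensorProduct.tmul, TensorProduct.add_tmul, map_add] at h h' ⊢
      rw [h, h']
  d_mem := by
    intro x hx
    have hx' : Φ x = x ᵍ⊗ₜ[ℂ] 1 := hx
    change Φ (A.d x) = (A.d x) ᵍ⊗ₜ[ℂ] (1 : C)
    rw [Φ.map_d, hx', GDSAlg.tensorD_tmul, C.d_one]
    simp [GradedTensorProduct.tmul]

theorem mem_invariants (x : A) : x ∈ Φ.invariants ↔ Φ x = x ᵍ⊗ₜ[ℂ] (1 : C) := Iff.rfl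

end DGCoaction

namespace DGSub

variable {A : GDSAlg.{u}} {B : GDSAlg.{v}} (K : DGSub A) (K' : DGSub B)

theorem parity_mem (x : A) (hx : x ∈ K) : A.parity x ∈ K := by
  obtain ⟨N, hN⟩ := sum_proj A.gr x
  rw [hN, map_sum]
  refine K.toSubalgebra.sum_mem fun n _ => ?_
  rw [GDSAlg.parity_apply (QPB.proj_mem A.gr n x)]
  exact K.toSubalgebra.smul_mem (K.proj_mem n x hx) _

/-- The algebra of closed elements of a graded-differential subalgebra. -/
def cocycles : Subalgebra ℂ A where
  carrier := {x | x ∈ K ∧ A.d x = 0}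
  mul_mem' := by
    rintro x y ⟨hx, hx'⟩ ⟨hy, hy'⟩
    exact ⟨K.toSubalgebra.mul_mem hx hy, by rw [A.leibniz, hx', hy']; simp⟩
  add_mem' := by
    rintro x y ⟨hx, hx'⟩ ⟨hy, hy'⟩
    exact ⟨K.toSubalgebra.add_mem hx hy, by rw [map_add, hx', hy', add_zero]⟩
  algebraMap_mem' := by
    intro r
    exact ⟨K.toSubalgebra.algebraMap_mem r, by
      rw [Algebra.algebraMap_eq_smul_one, map_smul, A.d_one, smul_zero]⟩

/-- The ideal of exact elements (differentials of elements of the subalgebra). -/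
def coboundaries : Ideal K.cocycles where
  carrier := {z | ∃ y ∈ K, A.d y = z}
  add_mem' := by
    rintro x y ⟨a, ha, hx⟩ ⟨b, hb, hy⟩
    exact ⟨a + b, K.toSubalgebra.add_mem ha hb, by simp [hx, hy]⟩
  zero_mem' := ⟨0, K.toSubalgebra.zero_mem, by simp⟩
  smul_mem' := by
    rintro c x ⟨a, ha, hx⟩
    refine ⟨A.parity c * a, K.toSubalgebra.mul_mem (K.parity_mem c c.2.1) ha, ?_⟩
    have hc : A.d c = 0 := c.2.2
    simp [A.leibniz, A.d_parity, hc, A.parity_parity, hx]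

instance : K.coboundaries.IsTwoSided where
  mul_mem_of_left := by
    rintro x c ⟨a, ha, h⟩
    refine ⟨a * c, K.toSubalgebra.mul_mem ha c.2.1, ?_⟩
    have hc : A.d c = 0 := c.2.2
    simp [A.leibniz, hc, h]

/-- The cohomology algebra of a graded-differential subalgebra. -/
abbrev Cohomology : Type u := K.cocycles ⧸ K.coboundaries

variable {K K'}

/-- The homomorphism of cohomology algebras induced by a homomorphism `f` of differential algebras
that maps `K` into `K'`. -/
def cohomologyMap (f : DGHom A B) (hf : ∀ x ∈ K, f x ∈ K') : K.Cohomology →ₐ[ℂ] K'.Cohomology :=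
  Ideal.quotientMapₐ K'.coboundaries
    ((f.toAlgHom.comp K.cocycles.val).codRestrict K'.cocycles
      (fun x => ⟨hf x x.2.1, by
        have := f.map_d x
        rw [x.2.2, map_zero] at this
        exact this.symm⟩))
    (by
      rintro x ⟨y, hy, h⟩
      exact ⟨f y, hf y hy, by rw [← f.map_d, h]; rfl⟩)

end DGSub

/-! ### Free graded-differential *-algebras -/

section Conj

variable (B : Type*) [Ring B] [Algebra ℂ B]

/-- The opposite algebra with the conjugate scalar multiplication; algebra homomorphisms into it are
antilinear antimultiplicative maps. -/
def ConjOp : Type _ := Bᵐᵒᵖ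

instance : Ring (ConjOp B) := inferInstanceAs (Ring Bᵐᵒᵖ)

instance : Algebra ℂ (ConjOp B) :=
  RingHom.toAlgebra' ((algebraMap ℂ Bᵐᵒᵖ).comp (starRingEnd ℂ) : ℂ →+* Bᵐᵒᵖ)
    (fun c x => Algebra.commutes (A := Bᵐᵒᵖ) (starRingEnd ℂ c) x)

theorem ConjOp.unop_smul (c : ℂ) (x : ConjOp B) :
    MulOpposite.unop (c • x : ConjOp B) = (starRingEnd ℂ c) • (MulOpposite.unop x : B) := by
  rw [Algebra.smul_def]
  change MulOpposite.unop ((algebraMap ℂ Bᵐᵒᵖ (starRingEnd ℂ c) : Bᵐᵒᵖ) * (show Bᵐᵒᵖ from x)) = _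
  rw [MulOpposite.unop_mul]
  change (MulOpposite.unop x : B) * algebraMap ℂ B (starRingEnd ℂ c) = _
  rw [← Algebra.commutes, ← Algebra.smul_def]

end Conj

namespace Free

variable {V : Type u} [AddCommGroup V] [Module ℂ V]

/-- The generators of the free graded-differential algebra: `inl v` stands for `v` and `inr v` for
`d v`. -/
def gen : V ⊕ V → TensorAlgebra ℂ (V × V)
  | Sum.inl v => TensorAlgebra.ι ℂ (v, 0)
  | Sum.inr v => TensorAlgebra.ι ℂ (0, v)

/-- The degree of a generator, if `V` is placed in degree `k`. -/
def wt (k : ℕ) : V ⊕ V → ℕ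
  | Sum.inl _ => k
  | Sum.inr _ => k + 1

variable (V) in
/-- The span of the words of degree `n` in the generators. -/
def gr (k n : ℕ) : Submodule ℂ (TensorAlgebra ℂ (V × V)) :=
  Submodule.span ℂ {x | ∃ l : List (V ⊕ V), (l.map (wt k)).sum = n ∧ x = (l.map gen).prod}

theorem gen_mem (k : ℕ) (g : V ⊕ V) : gen g ∈ gr V k (wt k g) :=
  Submodule.subset_span ⟨[g], by simp, by simp⟩

theorem word_mem (k : ℕ) (l : List (V ⊕ V)) : (l.map gen).prod ∈ gr V k (l.map (wt k)).sum :=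
  Submodule.subset_span ⟨l, rfl, rfl⟩

theorem ι_eq (v v' : V) : TensorAlgebra.ι ℂ (v, v') = gen (Sum.inl v) + gen (Sum.inr v') := by
  simp [gen, ← map_add]

instance gradedMonoid (k : ℕ) : SetLike.GradedMonoid (gr V k) where
  one_mem := Submodule.subset_span ⟨[], by simp, by simp⟩
  mul_mem := by
    intro m n x y hx hy
    have : gr V k m * gr V k n ≤ gr V k (m + n) := by
      rw [gr, gr, Submodule.span_mul_span, Submodule.span_le]
      rintro _ ⟨_, ⟨l, rfl, rfl⟩, _, ⟨l', rfl, rfl⟩, rfl⟩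
      exact Submodule.subset_span ⟨l ++ l', by simp, by simp⟩
    exact this (Submodule.mul_mem_mul hx hy)

/-- The map into the direct sum of the homogeneous components. -/
def decomp (k : ℕ) : TensorAlgebra ℂ (V × V) →ₐ[ℂ] ⨁ n, gr V k n :=
  TensorAlgebra.lift ℂ
    (LinearMap.coprod
      (DirectSum.lof ℂ ℕ (fun n => gr V k n) k ∘ₗ LinearMap.codRestrict _
        (TensorAlgebra.ι ℂ ∘ₗ LinearMap.inl ℂ V V) (fun v => gen_mem k (Sum.inl v)))
      (DirectSum.lof ℂ ℕ (fun n => gr V k n) (k + 1) ∘ₗ LinearMap.codRestrict _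
        (TensorAlgebra.ι ℂ ∘ₗ LinearMap.inr ℂ V V) (fun v => gen_mem k (Sum.inr v))))

theorem decomp_gen (k : ℕ) (g : V ⊕ V) :
    decomp k (gen g) = DirectSum.of (fun n => gr V k n) (wt k g) ⟨gen g, gen_mem k g⟩ := by
  rcases g with v | v
  · simp only [gen, decomp, TensorAlgebra.lift_ι_apply, LinearMap.coprod_apply, map_zero, add_zero]
    rfl
  · simp only [gen, decomp, TensorAlgebra.lift_ι_apply, LinearMap.coprod_apply, map_zero, zero_add]
    rfl

theorem decomp_word (k : ℕ) (l : List (V ⊕ V)) :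
    decomp k (l.map gen).prod = DirectSum.of (fun n => gr V k n) _ ⟨_, word_mem k l⟩ := by
  induction l with
  | nil => simp only [List.map_nil, List.prod_nil, map_one]; rfl
  | cons g l ih =>
    simp only [List.map_cons, List.prod_cons, map_mul, ih, decomp_gen, DirectSum.of_mul_of]
    rfl

instance graded (k : ℕ) : GradedAlgebra (gr V k) :=
  GradedAlgebra.ofAlgHom _ (decomp k)
    (by
      ext v
      · have := decomp_gen k (Sum.inl v)
        simp only [gen] at this
        simp [this]
      · have := decomp_gen k (Sum.inr v)
        simp only [gen] at this
        simp [this])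
    (by
      rintro n ⟨x, hx⟩
      simp only
      induction hx using Submodule.span_induction with
      | zero => rw [map_zero]; exact (map_zero (DirectSum.of (fun n => gr V k n) n)).symm
      | add x y hx hy ihx ihy => rw [map_add, ihx, ihy, ← map_add]; rfl
      | smul c x hx ih =>
        rw [map_smul, ih, ← DirectSum.lof_eq_of ℂ, ← DirectSum.lof_eq_of ℂ, ← map_smul]; rfl
      | mem x hx =>
        obtain ⟨l, rfl, rfl⟩ := hx
        exact decomp_word k l)

/-- Induction along words. -/
theorem word_induction {p : TensorAlgebra ℂ (V × V) → Prop} (h1 : p 1)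
    (hgen : ∀ g x, p x → p (gen g * x)) (hadd : ∀ x y, p x → p y → p (x + y))
    (hsmul : ∀ (c : ℂ) x, p x → p (c • x)) (x : TensorAlgebra ℂ (V × V)) : p x := by
  refine hom_induction (gr V 0) (fun n x hx => ?_) hadd x
  induction hx using Submodule.span_induction with
  | zero => simpa using hsmul 0 1 h1
  | add x y _ _ ihx ihy => exact hadd _ _ ihx ihy
  | smul c x _ ih => exact hsmul c x ih
  | mem x hx =>
    obtain ⟨l, -, rfl⟩ := hx
    induction l with
    | nil => simpa using h1
    | cons g l ih => simpa using hgen g _ ih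

/-- The parity automorphism. -/
def par (k : ℕ) : TensorAlgebra ℂ (V × V) →ₐ[ℂ] TensorAlgebra ℂ (V × V) :=
  TensorAlgebra.lift ℂ (TensorAlgebra.ι ℂ ∘ₗ
    LinearMap.prodMap ((-1 : ℂ) ^ k • LinearMap.id) ((-1 : ℂ) ^ (k + 1) • LinearMap.id))

theorem par_gen (k : ℕ) (g : V ⊕ V) : par k (gen g) = (-1 : ℂ) ^ (wt k g) • gen g := by
  rcases g with v | v
  · simp only [par, gen, wt, TensorAlgebra.lift_ι_apply, LinearMap.comp_apply]
    rw [← map_smul]; congr 1; ext <;> simp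
  · simp only [par, gen, wt, TensorAlgebra.lift_ι_apply, LinearMap.comp_apply]
    rw [← map_smul]; congr 1; ext <;> simp

theorem par_apply {k n : ℕ} {x : TensorAlgebra ℂ (V × V)} (hx : x ∈ gr V k n) :
    par k x = (-1 : ℂ) ^ n • x := by
  induction hx using Submodule.span_induction with
  | zero => simp
  | add x y _ _ h h' => rw [map_add, h, h', smul_add]
  | smul c x _ h => rw [map_smul, h, smul_comm]
  | mem x hx =>
    obtain ⟨l, rfl, rfl⟩ := hx
    induction l with
    | nil => simp
    | cons g l ih =>
      simp only [List.map_cons, List.prod_cons, List.sum_cons, map_mul, ih, par_gen, pow_add,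
        smul_mul_smul_comm]

/-- The homomorphism `x ↦ !![par x, d x; 0, x]` encoding the differential. -/
def dMat (k : ℕ) : TensorAlgebra ℂ (V × V) →ₐ[ℂ] Matrix (Fin 2) (Fin 2) (TensorAlgebra ℂ (V × V)) :=
  TensorAlgebra.lift ℂ
    { toFun := fun v => !![par k (TensorAlgebra.ι ℂ v), TensorAlgebra.ι ℂ (LinearMap.inr ℂ V V v.1);
        0, TensorAlgebra.ι ℂ v]
      map_add' := by
        intro x y
        ext i j
        fin_cases i <;> fin_cases j <;> simp [-LinearMap.coe_inr]
      map_smul' := by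
        intro c x
        ext i j
        fin_cases i <;> fin_cases j <;> simp [-LinearMap.coe_inr] }

theorem dMat_apply (k : ℕ) (x : TensorAlgebra ℂ (V × V)) :
    dMat k x = !![par k x, dMat k x 0 1; 0, x] := by
  have h10 : ∀ x : TensorAlgebra ℂ (V × V), dMat k x 1 0 = 0 ∧ dMat k x 0 0 = par k x ∧
      dMat k x 1 1 = x := by
    intro x
    induction x using TensorAlgebra.induction with
    | algebraMap r => simp [Matrix.algebraMap_matrix_apply]
    | ι v => simp [dMat]
    | mul x y hx hy =>
      obtain ⟨a, b, c⟩ := hx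
      obtain ⟨a', b', c'⟩ := hy
      simp [Matrix.mul_apply, Fin.sum_univ_two, a, b, c, a', b', c']
    | add x y hx hy =>
      obtain ⟨a, b, c⟩ := hx
      obtain ⟨a', b', c'⟩ := hy
      simp [a, b, c, a', b', c']
  obtain ⟨a, b, c⟩ := h10 x
  ext i j
  fin_cases i <;> fin_cases j <;> simp [a, b, c]

/-- The differential: the antiderivation with `d v = (0, v)` and `d (0, v) = 0` on generators. -/
def d (k : ℕ) : TensorAlgebra ℂ (V × V) →ₗ[ℂ] TensorAlgebra ℂ (V × V) where
  toFun x := dMat k x 0 1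
  map_add' := by simp
  map_smul' := by simp

theorem d_mul (k : ℕ) (x y : TensorAlgebra ℂ (V × V)) :
    d k (x * y) = d k x * y + par k x * d k y := by
  change dMat k (x * y) 0 1 = dMat k x 0 1 * y + par k x * dMat k y 0 1
  rw [map_mul, dMat_apply k x, dMat_apply k y]
  simp [Matrix.mul_apply, Fin.sum_univ_two, add_comm]

theorem d_inl (k : ℕ) (v : V) : d k (gen (Sum.inl v)) = gen (Sum.inr v) := by
  simp [d, dMat, gen]

theorem d_inr (k : ℕ) (v : V) : d k (gen (Sum.inr v)) = 0 := by
  change dMat k _ 0 1 = 0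
  simp [dMat, gen]

theorem d_one (k : ℕ) : d k (1 : TensorAlgebra ℂ (V × V)) = 0 := by
  simp [d]

theorem d_gen_mem (k : ℕ) (g : V ⊕ V) : d k (gen g) ∈ gr V k (wt k g + 1) := by
  rcases g with v | v
  · rw [d_inl]; exact gen_mem k (Sum.inr v)
  · rw [d_inr]; exact zero_mem _

theorem d_mem (k n : ℕ) (x : TensorAlgebra ℂ (V × V)) (hx : x ∈ gr V k n) :
    d k x ∈ gr V k (n + 1) := by
  induction hx using Submodule.span_induction with
  | zero => simp
  | add x y _ _ h h' => rw [map_add]; exact add_mem h h'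
  | smul c x _ h => rw [map_smul]; exact Submodule.smul_mem _ _ h
  | mem x hx =>
    obtain ⟨l, rfl, rfl⟩ := hx
    induction l with
    | nil => simp [d_one]
    | cons g l ih =>
      simp only [List.map_cons, List.prod_cons, List.sum_cons, d_mul, par_gen]
      refine add_mem ?_ ?_
      · have := SetLike.GradedMul.mul_mem (d_gen_mem k g) (word_mem k l)
        rwa [add_right_comm] at this
      · rw [smul_mul_assoc, add_assoc]
        exact Submodule.smul_mem _ _ (SetLike.GradedMul.mul_mem (gen_mem k g) ih)

theorem par_par (k : ℕ) (x : TensorAlgebra ℂ (V × V)) : par k (par k x) = x := by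
  refine word_induction (p := fun x => par k (par k x) = x) ?_ ?_ ?_ ?_ x
  · simp
  · intro g x h
    rw [map_mul, par_gen, map_mul, map_smul, par_gen, smul_smul, ← mul_pow, h]; simp
  · intro x y h h'; simp [h, h']
  · intro c x h; simp [h]

theorem d_par (k : ℕ) (x : TensorAlgebra ℂ (V × V)) : d k (par k x) = - par k (d k x) := by
  refine hom_induction (gr V k) (p := fun x => d k (par k x) = - par k (d k x)) ?_ ?_ x
  · intro n x hx
    rw [par_apply hx, par_apply (d_mem k n x hx), map_smul, pow_succ]; simp
  · intro x y h h'; simp only [map_add, h, h']; abel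

theorem d_d (k : ℕ) (x : TensorAlgebra ℂ (V × V)) : d k (d k x) = 0 := by
  refine word_induction (p := fun x => d k (d k x) = 0) ?_ ?_ ?_ ?_ x
  · simp [d_one]
  · intro g x h
    have hg : d k (d k (gen g)) = 0 := by
      rcases g with v | v
      · rw [d_inl, d_inr]
      · rw [d_inr, map_zero]
    rw [d_mul, map_add, d_mul, d_mul, hg, h, d_par]; simp
  · intro x y h h'; simp [h, h']
  · intro c x h; simp [h]

/-- The sign `(-1)^(n(n-1)/2)` of the reversal of `n` factors of degree one. -/
def sgn (n : ℕ) : ℂ := (-1) ^ (n * (n - 1) / 2)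

theorem sgn_succ (n : ℕ) : sgn (n + 1) = sgn n * (-1) ^ n := by
  rw [sgn, sgn, ← pow_add, Nat.triangle_succ]

theorem sgn_add (m n : ℕ) : sgn (m + n) = sgn m * sgn n * (-1) ^ (m * n) := by
  induction n with
  | zero => simp [sgn]
  | succ n ih =>
    rw [← add_assoc, sgn_succ, ih, sgn_succ, pow_add, mul_add, mul_one, pow_add]; ring

theorem sgn_mul_self (n : ℕ) : sgn n * sgn n = 1 := by
  rw [sgn, ← mul_pow]; simp

theorem star_sgn (n : ℕ) : starRingEnd ℂ (sgn n) = sgn n := by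
  simp [sgn]

variable (s : V →ₛₗ[starRingEnd ℂ] V)

/-- The antilinear antimultiplicative map acting on the generators as `sgn` times `s`. -/
def revHom (k : ℕ) : TensorAlgebra ℂ (V × V) →ₐ[ℂ] ConjOp (TensorAlgebra ℂ (V × V)) :=
  TensorAlgebra.lift ℂ
    { toFun := fun v => (MulOpposite.op
        (TensorAlgebra.ι ℂ (sgn k • s v.1, sgn (k + 1) • s v.2)) : (TensorAlgebra ℂ (V × V))ᵐᵒᵖ)
      map_add' := by
        intro x y
        apply MulOpposite.unop_injective
        change TensorAlgebra.ι ℂ _ = TensorAlgebra.ι ℂ _ + TensorAlgebra.ι ℂ _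
        rw [← map_add]; congr 1; ext <;> simp
      map_smul' := by
        intro c x
        apply MulOpposite.unop_injective
        refine Eq.trans ?_ (ConjOp.unop_smul _ _ _).symm
        change TensorAlgebra.ι ℂ _ = _ • TensorAlgebra.ι ℂ _
        rw [← LinearMap.map_smul (TensorAlgebra.ι ℂ)]; congr 1
        ext <;> simp [smul_smul, mul_comm] }

/-- The map of `revHom` as an antilinear map. -/
def rev (k : ℕ) : TensorAlgebra ℂ (V × V) →ₛₗ[starRingEnd ℂ] TensorAlgebra ℂ (V × V) where
  toFun x := MulOpposite.unop (revHom s k x : (TensorAlgebra ℂ (V × V))ᵐᵒᵖ)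
  map_add' x y := by rw [map_add]; rfl
  map_smul' c x := by rw [map_smul]; exact ConjOp.unop_smul _ _ _

theorem rev_mul (k : ℕ) (x y : TensorAlgebra ℂ (V × V)) :
    rev s k (x * y) = rev s k y * rev s k x := by
  change MulOpposite.unop (revHom s k (x * y) : (TensorAlgebra ℂ (V × V))ᵐᵒᵖ) = _
  rw [map_mul]; rfl

theorem rev_one (k : ℕ) : rev s k 1 = 1 := by
  change MulOpposite.unop (revHom s k 1 : (TensorAlgebra ℂ (V × V))ᵐᵒᵖ) = _
  rw [map_one]; rfl

theorem rev_gen (k : ℕ) (g : V ⊕ V) :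
    rev s k (gen g) = sgn (wt k g) • gen (Sum.map s s g) := by
  rcases g with v | v
  · change MulOpposite.unop (revHom s k _ : (TensorAlgebra ℂ (V × V))ᵐᵒᵖ) = _
    simp only [revHom, gen, TensorAlgebra.lift_ι_apply]
    change TensorAlgebra.ι ℂ (sgn k • s v, sgn (k + 1) • s 0) = sgn k • TensorAlgebra.ι ℂ (s v, 0)
    rw [← LinearMap.map_smul (TensorAlgebra.ι ℂ)]; congr 1; ext <;> simp
  · change MulOpposite.unop (revHom s k _ : (TensorAlgebra ℂ (V × V))ᵐᵒᵖ) = _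
    simp only [revHom, gen, TensorAlgebra.lift_ι_apply]
    change TensorAlgebra.ι ℂ (sgn k • s 0, sgn (k + 1) • s v) =
      sgn (k + 1) • TensorAlgebra.ι ℂ (0, s v)
    rw [← LinearMap.map_smul (TensorAlgebra.ι ℂ)]; congr 1; ext <;> simp

theorem wt_map (k : ℕ) (g : V ⊕ V) : wt k (Sum.map s s g) = wt k g := by
  rcases g with v | v <;> rfl

theorem rev_gen_mem (k : ℕ) (g : V ⊕ V) : rev s k (gen g) ∈ gr V k (wt k g) := by
  rw [rev_gen]
  have := gen_mem k (Sum.map s s g)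
  rw [wt_map] at this
  exact Submodule.smul_mem _ _ this

theorem rev_mem (k n : ℕ) (x : TensorAlgebra ℂ (V × V)) (hx : x ∈ gr V k n) :
    rev s k x ∈ gr V k n := by
  induction hx using Submodule.span_induction with
  | zero => simp
  | add x y _ _ h h' => rw [map_add]; exact add_mem h h'
  | smul c x _ h => rw [LinearMap.map_smulₛₗ]; exact Submodule.smul_mem _ _ h
  | mem x hx =>
    obtain ⟨l, rfl, rfl⟩ := hx
    induction l with
    | nil => simpa [rev_one] using SetLike.GradedOne.one_mem (A := gr V k)
    | cons g l ih =>
      simp only [List.map_cons, List.prod_cons, List.sum_cons, rev_mul]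
      rw [add_comm]
      exact SetLike.GradedMul.mul_mem ih (rev_gen_mem s k g)

theorem rev_rev (hs : ∀ v, s (s v) = v) (k : ℕ) (x : TensorAlgebra ℂ (V × V)) :
    rev s k (rev s k x) = x := by
  refine word_induction (p := fun x => rev s k (rev s k x) = x) ?_ ?_ ?_ ?_ x
  · simp [rev_one]
  · intro g x h
    have hg : Sum.map s s (Sum.map s s g) = g := by rcases g with v | v <;> simp [hs]
    rw [rev_mul, rev_mul, h, rev_gen, LinearMap.map_smulₛₗ, rev_gen, wt_map, hg, star_sgn,
      smul_smul, sgn_mul_self, one_smul]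
  · intro x y h h'; simp [h, h']
  · intro c x h; simp [h]

theorem rev_par (k : ℕ) (x : TensorAlgebra ℂ (V × V)) : rev s k (par k x) = par k (rev s k x) := by
  refine hom_induction (gr V k) (p := fun x => rev s k (par k x) = par k (rev s k x)) ?_ ?_ x
  · intro n x hx
    rw [par_apply hx, par_apply (rev_mem s k n x hx), LinearMap.map_smulₛₗ]; simp
  · intro x y h h'; simp only [map_add, h, h']

theorem rev_d (k : ℕ) (x : TensorAlgebra ℂ (V × V)) :
    rev s k (d k x) = d k (rev s k (par k x)) := by
  refine word_induction (p := fun x => rev s k (d k x) = d k (rev s k (par k x))) ?_ ?_ ?_ ?_ x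
  · simp [rev_one, d_one]
  · intro g x h
    have hg : rev s k (d k (gen g)) = d k (rev s k (par k (gen g))) := by
      rcases g with v | v
      · rw [d_inl, rev_gen, par_gen, LinearMap.map_smulₛₗ, rev_gen, map_smul, map_smul]
        simp only [Sum.map_inl, Sum.map_inr, d_inl, wt, smul_smul, sgn_succ]
        simp [mul_comm]
      · rw [d_inr, par_gen, LinearMap.map_smulₛₗ, rev_gen, map_smul, map_smul]
        simp [d_inr]
    rw [d_mul, map_add, rev_mul, rev_mul, h, hg, map_mul, rev_mul, d_mul, rev_par s k x, par_par]
    rw [add_comm]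
  · intro x y h h'; simp [h, h']
  · intro c x h; simp [h]

/-- The *-structure of the free graded-differential algebra. -/
def st (k : ℕ) : TensorAlgebra ℂ (V × V) →ₛₗ[starRingEnd ℂ] TensorAlgebra ℂ (V × V) :=
  (gradeScale (gr V k) sgn).comp (rev s k)

theorem st_apply {k n : ℕ} {x : TensorAlgebra ℂ (V × V)} (hx : x ∈ gr V k n) :
    st s k x = sgn n • rev s k x :=
  gradeScale_apply _ _ (rev_mem s k n x hx)

end Free

/-- The free graded-differential *-algebra generated by a vector space `V` with an antilinear
involution `s`, placed in degree `k`: the tensor algebra over `V ⊕ dV`. -/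
def free (V : Type u) [AddCommGroup V] [Module ℂ V] (s : V →ₛₗ[starRingEnd ℂ] V)
    (hs : ∀ v, s (s v) = v) (k : ℕ) : GDSAlg.{u} where
  carrier := TensorAlgebra ℂ (V × V)
  gr := Free.gr V k
  d := Free.d k
  st := Free.st s k
  d_mem := Free.d_mem k
  d_d := Free.d_d k
  d_mul := by
    intro n x hx y
    rw [Free.d_mul, Free.par_apply hx, smul_mul_assoc]
  st_mem := by
    intro n x hx
    rw [Free.st_apply s hx]
    exact Submodule.smul_mem _ _ (Free.rev_mem s k n x hx)
  st_st := by
    intro x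
    refine hom_induction (Free.gr V k) (p := fun x => Free.st s k (Free.st s k x) = x) ?_ ?_ x
    · intro n x hx
      rw [Free.st_apply s hx, LinearMap.map_smulₛₗ, Free.st_apply s (Free.rev_mem s k n x hx),
        Free.rev_rev s hs, Free.star_sgn, smul_smul, Free.sgn_mul_self, one_smul]
    · intro x y h h'; simp [h, h']
  st_mul := by
    intro m n x hx y hy
    rw [Free.st_apply s (SetLike.GradedMul.mul_mem hx hy), Free.st_apply s hx, Free.st_apply s hy,
      Free.rev_mul, smul_mul_smul_comm, smul_smul, Free.sgn_add]
    congr 1; ring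
  st_d := by
    intro x
    refine hom_induction (Free.gr V k)
      (p := fun x => Free.st s k (Free.d k x) = Free.d k (Free.st s k x)) ?_ ?_ x
    · intro n x hx
      rw [Free.st_apply s hx, Free.st_apply s (Free.d_mem k n x hx), Free.rev_d, Free.par_apply hx,
        LinearMap.map_smulₛₗ, map_smul, map_smul, smul_smul, Free.sgn_succ]
      congr 1
      have : (-1 : ℂ) ^ n * (-1) ^ n = 1 := by rw [← mul_pow]; simp
      simp [mul_assoc, this]
    · intro x y h h'; simp [h, h']

/-! ### Quotients -/

section Lift

variable {M N L : Type*} [AddCommGroup M] [Module ℂ M] [AddCommGroup N] [Module ℂ N]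
  [AddCommGroup L] [Module ℂ L] {σ : ℂ →+* ℂ}

/-- The (semi)linear map `g` with `g ∘ p = f`, for a surjection `p` whose kernel is killed by `f`. -/
def liftSurj (p : M →ₗ[ℂ] N) (hp : Function.Surjective p) (f : M →ₛₗ[σ] L)
    (h : ∀ x, p x = 0 → f x = 0) : N →ₛₗ[σ] L where
  toFun y := f (Function.surjInv hp y)
  map_add' x y := by
    rw [← sub_eq_zero, ← map_add, ← map_sub]
    apply h
    simp [Function.surjInv_eq]
  map_smul' c x := by
    rw [← sub_eq_zero, ← LinearMap.map_smulₛₗ, ← map_sub]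
    apply h
    simp [Function.surjInv_eq]

theorem liftSurj_apply (p : M →ₗ[ℂ] N) (hp : Function.Surjective p) (f : M →ₛₗ[σ] L)
    (h : ∀ x, p x = 0 → f x = 0) (x : M) : liftSurj p hp f h (p x) = f x := by
  change f _ = f x
  rw [← sub_eq_zero, ← map_sub]
  apply h
  simp [Function.surjInv_eq]

end Lift

/-- A graded-differential *-ideal. -/
structure DGIdeal (A : GDSAlg.{u}) where
  toIdeal : Ideal A
  mul_mem_right : ∀ x ∈ toIdeal, ∀ y, x * y ∈ toIdeal
  proj_mem : ∀ n, ∀ x ∈ toIdeal, A.proj n x ∈ toIdeal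
  d_mem : ∀ x ∈ toIdeal, A.d x ∈ toIdeal
  st_mem : ∀ x ∈ toIdeal, A.st x ∈ toIdeal

namespace DGIdeal

variable {A : GDSAlg.{u}} (I : DGIdeal A)

instance : I.toIdeal.IsTwoSided := ⟨fun {a} b ha => I.mul_mem_right a ha b⟩

/-- The smallest graded-differential *-ideal containing a given set. -/
def span (S : Set A) : DGIdeal A where
  toIdeal := sInf {J | ∃ I : DGIdeal A, I.toIdeal = J ∧ S ⊆ J}
  mul_mem_right := by
    intro x hx y
    simp only [Submodule.mem_sInf] at hx ⊢
    rintro _ ⟨I, rfl, hI⟩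
    exact I.mul_mem_right x (hx _ ⟨I, rfl, hI⟩) y
  proj_mem := by
    intro n x hx
    simp only [Submodule.mem_sInf] at hx ⊢
    rintro _ ⟨I, rfl, hI⟩
    exact I.proj_mem n x (hx _ ⟨I, rfl, hI⟩)
  d_mem := by
    intro x hx
    simp only [Submodule.mem_sInf] at hx ⊢
    rintro _ ⟨I, rfl, hI⟩
    exact I.d_mem x (hx _ ⟨I, rfl, hI⟩)
  st_mem := by
    intro x hx
    simp only [Submodule.mem_sInf] at hx ⊢
    rintro _ ⟨I, rfl, hI⟩
    exact I.st_mem x (hx _ ⟨I, rfl, hI⟩)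

theorem subset_span (S : Set A) {x : A} (hx : x ∈ S) : x ∈ (span S).toIdeal := by
  simp only [span, Submodule.mem_sInf]
  rintro _ ⟨I, rfl, hI⟩
  exact hI hx

/-- The quotient map, as an algebra homomorphism. -/
def proj : A →ₐ[ℂ] A ⧸ I.toIdeal := Ideal.Quotient.mkₐ ℂ I.toIdeal

theorem proj_surjective : Function.Surjective I.proj := Ideal.Quotient.mkₐ_surjective ℂ I.toIdeal

theorem proj_eq_zero {x : A} : I.proj x = 0 ↔ x ∈ I.toIdeal := Ideal.Quotient.eq_zero_iff_mem

/-- The grading of the quotient. -/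
def gr (n : ℕ) : Submodule ℂ (A ⧸ I.toIdeal) := (A.gr n).map I.proj.toLinearMap

theorem proj_mem_gr {n : ℕ} {x : A} (hx : x ∈ A.gr n) : I.proj x ∈ I.gr n := ⟨x, hx, rfl⟩

instance gradedMonoid : SetLike.GradedMonoid I.gr where
  one_mem := ⟨1, A.one_mem, map_one I.proj⟩
  mul_mem := by
    rintro m n _ _ ⟨x, hx, rfl⟩ ⟨y, hy, rfl⟩
    exact ⟨x * y, SetLike.GradedMul.mul_mem hx hy, map_mul I.proj x y⟩

/-- The projection between the homogeneous components of degree `n`. -/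
def projGr (n : ℕ) : A.gr n →ₗ[ℂ] I.gr n where
  toFun x := ⟨I.proj x, I.proj_mem_gr x.2⟩
  map_add' x y := Subtype.ext (map_add I.proj (x : A) y)
  map_smul' c x := Subtype.ext (map_smul I.proj c (x : A))

/-- The homogeneous decomposition of the image of an element in the quotient. -/
def decompA : A →ₐ[ℂ] ⨁ n, I.gr n :=
  (DirectSum.toAlgebra ℂ (fun n => A.gr n)
    (fun n => DirectSum.lof ℂ ℕ (fun n => I.gr n) n ∘ₗ I.projGr n)
    (by
      simp only [LinearMap.comp_apply, DirectSum.lof_eq_of]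
      exact congrArg (DirectSum.of (fun n => I.gr n) 0) (Subtype.ext (map_one I.proj)))
    (by
      intro i j x y
      simp only [LinearMap.comp_apply, DirectSum.lof_eq_of, DirectSum.of_mul_of]
      exact congrArg (DirectSum.of (fun n => I.gr n) (i + j))
        (Subtype.ext (map_mul I.proj (x : A) (y : A))))).comp
    (DirectSum.decomposeAlgEquiv A.gr).toAlgHom

theorem decompA_apply {n : ℕ} {x : A} (hx : x ∈ A.gr n) :
    I.decompA x = DirectSum.of (fun n => I.gr n) n ⟨I.proj x, I.proj_mem_gr hx⟩ := by
  have h : (DirectSum.decomposeAlgEquiv A.gr).toAlgHom x =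
      DirectSum.of (fun n => A.gr n) n (⟨x, hx⟩ : A.gr n) := DirectSum.decompose_of_mem A.gr hx
  rw [decompA, AlgHom.comp_apply, h]
  exact DirectSum.toAddMonoid_of
    (fun n => (DirectSum.lof ℂ ℕ (fun n => I.gr n) n ∘ₗ I.projGr n).toAddMonoidHom) n _

theorem decompA_eq_zero (x : A) (hx : x ∈ I.toIdeal) : I.decompA x = 0 := by
  obtain ⟨N, hN⟩ := sum_proj A.gr x
  rw [hN, map_sum]
  refine Finset.sum_eq_zero fun n _ => ?_
  rw [I.decompA_apply (QPB.proj_mem A.gr n x)]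
  have h0 : (⟨I.proj (A.proj n x), I.proj_mem_gr (QPB.proj_mem A.gr n x)⟩ : I.gr n) = 0 :=
    Subtype.ext (I.proj_eq_zero.2 (I.proj_mem n x hx))
  exact (congrArg (DirectSum.of (fun n => I.gr n) n) h0).trans (map_zero _)

instance graded : GradedAlgebra I.gr :=
  GradedAlgebra.ofAlgHom _ (Ideal.Quotient.liftₐ I.toIdeal I.decompA I.decompA_eq_zero)
    (by
      refine AlgHom.ext fun y => ?_
      obtain ⟨x, rfl⟩ := I.proj_surjective y
      change DirectSum.coeAlgHom I.gr (I.decompA x) = I.proj x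
      refine hom_induction A.gr
        (p := fun x => DirectSum.coeAlgHom I.gr (I.decompA x) = I.proj x) ?_ ?_ x
      · intro n x hx
        rw [I.decompA_apply hx, DirectSum.coeAlgHom_of]
      · intro x y h h'
        simp only [map_add, h, h'])
    (by
      rintro n ⟨_, x, hx, rfl⟩
      exact I.decompA_apply hx)

/-- The differential of the quotient. -/
def dQ : (A ⧸ I.toIdeal) →ₗ[ℂ] A ⧸ I.toIdeal :=
  liftSurj I.proj.toLinearMap I.proj_surjective (I.proj.toLinearMap ∘ₗ A.d)
    (fun x hx => I.proj_eq_zero.2 (I.d_mem x (I.proj_eq_zero.1 hx)))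

/-- The *-structure of the quotient. -/
def stQ : (A ⧸ I.toIdeal) →ₛₗ[starRingEnd ℂ] A ⧸ I.toIdeal :=
  liftSurj I.proj.toLinearMap I.proj_surjective (I.proj.toLinearMap.comp A.st)
    (fun x hx => I.proj_eq_zero.2 (I.st_mem x (I.proj_eq_zero.1 hx)))

theorem dQ_proj (x : A) : I.dQ (I.proj x) = I.proj (A.d x) :=
  liftSurj_apply I.proj.toLinearMap I.proj_surjective (I.proj.toLinearMap ∘ₗ A.d) _ x

theorem stQ_proj (x : A) : I.stQ (I.proj x) = I.proj (A.st x) :=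
  liftSurj_apply I.proj.toLinearMap I.proj_surjective (I.proj.toLinearMap.comp A.st) _ x

/-- The quotient of a graded-differential *-algebra by a graded-differential *-ideal. -/
def quotient : GDSAlg.{u} where
  carrier := A ⧸ I.toIdeal
  gr := I.gr
  d := I.dQ
  st := I.stQ
  d_mem := by
    rintro n _ ⟨x, hx, rfl⟩
    change I.dQ (I.proj x) ∈ I.gr (n + 1)
    rw [dQ_proj]
    exact I.proj_mem_gr (A.d_mem n x hx)
  d_d := by
    intro y
    obtain ⟨x, rfl⟩ := I.proj_surjective y
    rw [dQ_proj, dQ_proj, A.d_d, map_zero]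
  d_mul := by
    rintro n _ ⟨x, hx, rfl⟩ y
    obtain ⟨y, rfl⟩ := I.proj_surjective y
    change I.dQ (I.proj x * I.proj y) =
      I.dQ (I.proj x) * I.proj y + (-1 : ℂ) ^ n • (I.proj x * I.dQ (I.proj y))
    rw [← map_mul, dQ_proj, dQ_proj, dQ_proj, A.d_mul n x hx, map_add, map_smul, map_mul, map_mul]
  st_mem := by
    rintro n _ ⟨x, hx, rfl⟩
    change I.stQ (I.proj x) ∈ I.gr n
    rw [stQ_proj]
    exact I.proj_mem_gr (A.st_mem n x hx)
  st_st := by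
    intro y
    obtain ⟨x, rfl⟩ := I.proj_surjective y
    rw [stQ_proj, stQ_proj, A.st_st]
  st_mul := by
    rintro m n _ ⟨x, hx, rfl⟩ _ ⟨y, hy, rfl⟩
    change I.stQ (I.proj x * I.proj y) =
      (-1 : ℂ) ^ (m * n) • (I.stQ (I.proj y) * I.stQ (I.proj x))
    rw [← map_mul, stQ_proj, stQ_proj, stQ_proj, A.st_mul m n x hx y hy, map_smul, map_mul]
  st_d := by
    intro y
    obtain ⟨x, rfl⟩ := I.proj_surjective y
    rw [dQ_proj, stQ_proj, stQ_proj, dQ_proj, A.st_d]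

end DGIdeal

/-! ### Quantum groups and bicovariant first-order calculi -/

open TensorProduct
open Coalgebra (comul)

/-- The involution as an antilinear map. -/
def starMap (A : Type*) [AddCommGroup A] [StarAddMonoid A] [Module ℂ A] [StarModule ℂ A] :
    A →ₛₗ[starRingEnd ℂ] A := (starLinearEquiv ℂ (A := A)).toLinearMap

/-- A Hopf *-algebra is the algebra of polynomial functions on a compact matrix quantum group if
it is generated, as an algebra, by the matrix entries of a finite-dimensional unitary
corepresentation (a fundamental representation together with its conjugate). -/
class CompactMatrixQuantumGroup (𝒜 : Type u) [Ring 𝒜] [StarRing 𝒜] [HopfAlgebra ℂ 𝒜]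
    [StarModule ℂ 𝒜] : Prop where
  comul_star : ∀ a : 𝒜, comul (R := ℂ) (star a) = star (comul (R := ℂ) a)
  exists_fundamental : ∃ (n : ℕ) (u : Matrix (Fin n) (Fin n) 𝒜),
    u * u.conjTranspose = 1 ∧ u.conjTranspose * u = 1 ∧
    (∀ i j, comul (R := ℂ) (u i j) = ∑ k, u i k ⊗ₜ[ℂ] u k j) ∧
    Algebra.adjoin ℂ {x | ∃ i j, x = u i j} = ⊤

/-- A bicovariant first-order *-calculus `d : 𝒜 → Γ` over a quantum group: a bimodule `Γ` (left and
right multiplications `lact`, `ract`) spanned by the elements `a db`, with a *-structure, such that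
the left and right coactions `coactL : Γ → 𝒜 ⊗ Γ` and `coactR : Γ → Γ ⊗ 𝒜`,
`a db ↦ φ(a) (id ⊗ d)φ(b)` and `a db ↦ φ(a) (d ⊗ id)φ(b)`, are well defined. -/
structure BicovariantCalculus (𝒜 : Type u) [Ring 𝒜] [StarRing 𝒜] [HopfAlgebra ℂ 𝒜]
    [StarModule ℂ 𝒜] where
  carrier : Type u
  [addCommGroup : AddCommGroup carrier]
  [module : Module ℂ carrier]
  lact : 𝒜 →ₐ[ℂ] Module.End ℂ carrier
  ract : 𝒜ᵐᵒᵖ →ₐ[ℂ] Module.End ℂ carrier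
  lact_ract : ∀ a b ξ, lact a (ract b ξ) = ract b (lact a ξ)
  d : 𝒜 →ₗ[ℂ] carrier
  d_mul : ∀ a b, d (a * b) = ract (MulOpposite.op b) (d a) + lact a (d b)
  span_d : Submodule.span ℂ {ξ | ∃ a b, ξ = lact a (d b)} = ⊤
  st : carrier →ₛₗ[starRingEnd ℂ] carrier
  st_st : ∀ ξ, st (st ξ) = ξ
  st_lact : ∀ a ξ, st (lact a ξ) = ract (MulOpposite.op (star a)) (st ξ)
  st_d : ∀ a, st (d a) = d (star a)
  coactL : carrier →ₗ[ℂ] 𝒜 ⊗[ℂ] carrier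
  coactL_apply : ∀ a b, coactL (lact a (d b)) =
    map₂ (LinearMap.mul ℂ 𝒜) lact.toLinearMap (comul a) (map LinearMap.id d (comul b))
  coactR : carrier →ₗ[ℂ] carrier ⊗[ℂ] 𝒜
  coactR_apply : ∀ a b, coactR (lact a (d b)) =
    map₂ lact.toLinearMap (LinearMap.mul ℂ 𝒜) (comul a) (map d LinearMap.id (comul b))

attribute [instance] BicovariantCalculus.addCommGroup BicovariantCalculus.module

section Aux

variable {X A G : Type*} [AddCommGroup X] [Module ℂ X] [AddCommGroup A] [Module ℂ A]
  [AddCommGroup G] [Module ℂ G] (Δ : X →ₗ[ℂ] X ⊗[ℂ] X) (m : X →ₗ[ℂ] A) (g : X →ₗ[ℂ] G)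

theorem coact_aux_left (L : G →ₗ[ℂ] A ⊗[ℂ] G) (hL : ∀ t, L (g t) = map m g (Δ t))
    (x : X ⊗[ℂ] X) : TensorProduct.assoc ℂ A G A (L.rTensor A (map g m x)) =
      map m (map g m) (TensorProduct.assoc ℂ X X X (Δ.rTensor X x)) := by
  induction x using TensorProduct.induction_on with
  | zero => simp
  | add x y h h' => simp only [map_add, h, h']
  | tmul x y =>
    rw [map_tmul, LinearMap.rTensor_tmul, LinearMap.rTensor_tmul, hL]
    generalize Δ x = z
    induction z using TensorProduct.induction_on with
    | zero => simp
    | add x y h h' => simp only [map_add, add_tmul, h, h']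
    | tmul a b => simp

theorem coact_aux_right (R : G →ₗ[ℂ] G ⊗[ℂ] A) (hR : ∀ t, R (g t) = map g m (Δ t))
    (x : X ⊗[ℂ] X) : R.lTensor A (map m g x) = map m (map g m) (Δ.lTensor X x) := by
  induction x using TensorProduct.induction_on with
  | zero => simp
  | add x y h h' => simp only [map_add, h, h']
  | tmul x y => simp only [map_tmul, LinearMap.lTensor_tmul, hR]

end Aux

namespace BicovariantCalculus

variable {𝒜 : Type u} [Ring 𝒜] [StarRing 𝒜] [HopfAlgebra ℂ 𝒜] [StarModule ℂ 𝒜]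
  (Γ : BicovariantCalculus 𝒜)

/-- The map `a ⊗ b ↦ a db`. -/
def adb : 𝒜 ⊗[ℂ] 𝒜 →ₗ[ℂ] Γ.carrier :=
  lift ((Γ.lact.toLinearMap : 𝒜 →ₗ[ℂ] Γ.carrier →ₗ[ℂ] Γ.carrier).compl₂ Γ.d)

@[simp] theorem adb_tmul (a b : 𝒜) : Γ.adb (a ⊗ₜ b) = Γ.lact a (Γ.d b) := rfl

theorem adb_surjective : Function.Surjective Γ.adb := by
  rw [← LinearMap.range_eq_top, eq_top_iff, ← Γ.span_d, Submodule.span_le]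
  rintro _ ⟨a, b, rfl⟩
  exact ⟨a ⊗ₜ b, rfl⟩

theorem coactL_comp : Γ.coactL ∘ₗ Γ.adb = map (LinearMap.mul' ℂ 𝒜) Γ.adb ∘ₗ comul := by
  ext a b
  simp only [AlgebraTensorModule.curry_apply, LinearMap.restrictScalars_self, curry_apply,
    LinearMap.comp_apply, adb_tmul, coactL_apply, TensorProduct.comul_tmul]
  generalize (comul (R := ℂ) a) = x
  generalize (comul (R := ℂ) b) = y
  induction x using TensorProduct.induction_on with
  | zero => simp
  | add x x' h h' => simp only [map_add, LinearMap.add_apply, add_tmul, h, h']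
  | tmul a a' =>
    induction y using TensorProduct.induction_on with
    | zero => simp
    | add x x' h h' => simp only [map_add, tmul_add, h, h']
    | tmul b b' => simp

theorem coactR_comp : Γ.coactR ∘ₗ Γ.adb = map Γ.adb (LinearMap.mul' ℂ 𝒜) ∘ₗ comul := by
  ext a b
  simp only [AlgebraTensorModule.curry_apply, LinearMap.restrictScalars_self, curry_apply,
    LinearMap.comp_apply, adb_tmul, coactR_apply, TensorProduct.comul_tmul]
  generalize (comul (R := ℂ) a) = x
  generalize (comul (R := ℂ) b) = y
  induction x using TensorProduct.induction_on with
  | zero => simp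
  | add x x' h h' => simp only [map_add, LinearMap.add_apply, add_tmul, h, h']
  | tmul a a' =>
    induction y using TensorProduct.induction_on with
    | zero => simp
    | add x x' h h' => simp only [map_add, tmul_add, h, h']
    | tmul b b' => simp

/-- The left and right coactions commute. -/
theorem coact_comm (ξ : Γ.carrier) :
    TensorProduct.assoc ℂ 𝒜 Γ.carrier 𝒜 (Γ.coactL.rTensor 𝒜 (Γ.coactR ξ)) =
      Γ.coactR.lTensor 𝒜 (Γ.coactL ξ) := by
  obtain ⟨t, rfl⟩ := Γ.adb_surjective ξ
  have hL := fun t => LinearMap.congr_fun Γ.coactL_comp t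
  have hR := fun t => LinearMap.congr_fun Γ.coactR_comp t
  simp only [LinearMap.comp_apply] at hL hR
  rw [hL, hR, coact_aux_left _ _ _ _ hL, coact_aux_right _ _ _ _ hR]
  exact congrArg _ (Coalgebra.coassoc_apply t)

/-- The space of left-invariant elements of `Γ`. -/
def inv : Submodule ℂ Γ.carrier :=
  LinearMap.ker (Γ.coactL - TensorProduct.mk ℂ 𝒜 Γ.carrier 1)

theorem mem_inv {ξ : Γ.carrier} : ξ ∈ Γ.inv ↔ Γ.coactL ξ = 1 ⊗ₜ ξ := by
  simp [inv, sub_eq_zero]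

theorem coactR_mem (ξ : Γ.inv) : Γ.coactR ξ ∈ LinearMap.range (Γ.inv.subtype.rTensor 𝒜) := by
  have hex : Function.Exact Γ.inv.subtype
      (Γ.coactL - TensorProduct.mk ℂ 𝒜 Γ.carrier 1) := LinearMap.exact_subtype_ker_map _
  have := Module.Flat.rTensor_exact 𝒜 hex
  refine (this _).1 ?_
  have h := Γ.coact_comm ξ
  rw [Γ.mem_inv.1 ξ.2] at h
  rw [LinearMap.rTensor_sub]
  change Γ.coactL.rTensor 𝒜 _ - (TensorProduct.mk ℂ 𝒜 Γ.carrier 1).rTensor 𝒜 _ = 0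
  rw [sub_eq_zero]
  apply (TensorProduct.assoc ℂ 𝒜 Γ.carrier 𝒜).injective
  rw [h, LinearMap.lTensor_tmul]
  generalize Γ.coactR ξ = t
  induction t using TensorProduct.induction_on with
  | zero => simp
  | add x y h h' => simp only [map_add, tmul_add, h, h']
  | tmul x y => simp

/-- The adjoint action `ϖ : Γ_inv → Γ_inv ⊗ 𝒜`, the restriction of the right coaction. -/
def adj : Γ.inv →ₗ[ℂ] Γ.inv ⊗[ℂ] 𝒜 :=
  LinearMap.codRestrictOfInjective (Γ.coactR ∘ₗ Γ.inv.subtype) (Γ.inv.subtype.rTensor 𝒜)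
    (Module.Flat.rTensor_preserves_injective_linearMap _ Γ.inv.injective_subtype)
    (fun ξ => Γ.coactR_mem ξ)

theorem adj_spec (ξ : Γ.inv) : Γ.inv.subtype.rTensor 𝒜 (Γ.adj ξ) = Γ.coactR ξ :=
  LinearMap.codRestrictOfInjective_comp_apply _ _ _ _ ξ

section Star

theorem map_st_act (x : 𝒜 ⊗[ℂ] 𝒜) (y : 𝒜 ⊗[ℂ] 𝒜) :
    map (starMap 𝒜) Γ.st
      (map₂ (LinearMap.mul ℂ 𝒜) Γ.lact.toLinearMap x (map LinearMap.id Γ.d y)) =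
    map LinearMap.id Γ.d (star y * star x) -
      map₂ (LinearMap.mul ℂ 𝒜) Γ.lact.toLinearMap (star y) (map LinearMap.id Γ.d (star x)) := by
  induction x using TensorProduct.induction_on with
  | zero => simp
  | add x x' h h' =>
    simp only [map_add, LinearMap.add_apply, star_add, mul_add, h, h']; abel
  | tmul a a' =>
    induction y using TensorProduct.induction_on with
    | zero => simp
    | add x x' h h' =>
      simp only [map_add, LinearMap.add_apply, star_add, add_mul, h, h']; abel
    | tmul b b' =>
      simp [starMap, Γ.st_lact, Γ.st_d, Γ.d_mul, ← tmul_sub]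

variable [CompactMatrixQuantumGroup 𝒜]

theorem coactL_st (ξ : Γ.carrier) : Γ.coactL (Γ.st ξ) = map (starMap 𝒜) Γ.st (Γ.coactL ξ) := by
  obtain ⟨t, rfl⟩ := Γ.adb_surjective ξ
  induction t using TensorProduct.induction_on with
  | zero => simp
  | add x y h h' => simp only [map_add, h, h']
  | tmul a b =>
    have hd : ∀ c, Γ.coactL (Γ.d c) = map LinearMap.id Γ.d (comul c) := by
      intro c
      have := Γ.coactL_apply 1 c
      rw [map_one] at this
      refine this.trans ?_
      rw [Bialgebra.comul_one]
      generalize comul (R := ℂ) c = t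
      induction t using TensorProduct.induction_on with
      | zero => simp
      | add x y h h' => simp only [map_add, h, h']
      | tmul x y => simp [Algebra.TensorProduct.one_def]
    have h1 : Γ.st (Γ.adb (a ⊗ₜ b)) = Γ.d (star b * star a) - Γ.lact (star b) (Γ.d (star a)) := by
      rw [adb_tmul, Γ.st_lact, Γ.st_d, Γ.d_mul]; abel
    rw [h1, map_sub, hd, Γ.coactL_apply, adb_tmul, Γ.coactL_apply, map_st_act,
      Bialgebra.comul_mul, CompactMatrixQuantumGroup.comul_star,
      CompactMatrixQuantumGroup.comul_star]

/-- The *-structure of `Γ_inv`. -/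
def invSt : Γ.inv →ₛₗ[starRingEnd ℂ] Γ.inv where
  toFun ξ := ⟨Γ.st ξ, by
    rw [Γ.mem_inv, Γ.coactL_st, Γ.mem_inv.1 ξ.2, map_tmul]
    simp [starMap]⟩
  map_add' ξ η := Subtype.ext (by simp)
  map_smul' c ξ := Subtype.ext (by simp)

theorem invSt_invSt (ξ : Γ.inv) : Γ.invSt (Γ.invSt ξ) = ξ := Subtype.ext (Γ.st_st ξ)

end Star

/-! ### The universal envelope of `Γ` -/

/-- The free graded-differential *-algebra on the space `𝒜` in degree `0`. -/
def preEnvelope (𝒜 : Type u) [Ring 𝒜] [StarRing 𝒜] [HopfAlgebra ℂ 𝒜] [StarModule ℂ 𝒜] :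
    GDSAlg.{u} :=
  free 𝒜 (starMap 𝒜) (fun a => star_star a) 0

/-- The inclusion of generators `a`. -/
def preInl : 𝒜 →ₗ[ℂ] preEnvelope 𝒜 := TensorAlgebra.ι ℂ ∘ₗ LinearMap.inl ℂ 𝒜 𝒜

/-- The map `a ⊗ b ↦ a db` into the free graded-differential *-algebra. -/
def preAdb : 𝒜 ⊗[ℂ] 𝒜 →ₗ[ℂ] preEnvelope 𝒜 :=
  lift ((LinearMap.mul ℂ (preEnvelope 𝒜)).compl₁₂ preInl ((preEnvelope 𝒜).d ∘ₗ preInl))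

/-- The defining relations of the universal envelope of `Γ`: those of the algebra `𝒜`, and
`∑ aₖ dbₖ = 0` whenever this holds in `Γ`. -/
def relations : Set (preEnvelope 𝒜) :=
  {x | x = preInl 1 - 1 ∨ (∃ a b : 𝒜, x = preInl a * preInl b - preInl (a * b)) ∨
    ∃ t, Γ.adb t = 0 ∧ x = preAdb t}

/-- The universal differential envelope `Γ^∧` of the first-order calculus `Γ`. Since the ideal of
relations is closed under `d`, the relation `∑ aₖ dbₖ = 0` entails `∑ daₖ dbₖ = 0`. -/
def envelope : GDSAlg.{u} := (DGIdeal.span Γ.relations).quotient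

/-- The inclusion of `𝒜` into `Γ^∧`. -/
def envIncl : 𝒜 →ₐ[ℂ] Γ.envelope :=
  AlgHom.ofLinearMap ((DGIdeal.span Γ.relations).proj.toLinearMap ∘ₗ preInl)
    (by
      have := (DGIdeal.span Γ.relations).proj_eq_zero.2
        (DGIdeal.subset_span Γ.relations (Or.inl rfl))
      rw [map_sub, sub_eq_zero] at this
      exact this.trans (map_one _))
    (by
      intro a b
      have := (DGIdeal.span Γ.relations).proj_eq_zero.2
        (DGIdeal.subset_span Γ.relations (Or.inr (Or.inl ⟨a, b, rfl⟩)))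
      rw [map_sub, sub_eq_zero, map_mul] at this
      exact this.symm)

/-- The inclusion of `Γ` into `Γ^∧`. -/
def envInclΓ : Γ.carrier →ₗ[ℂ] Γ.envelope :=
  liftSurj Γ.adb Γ.adb_surjective ((DGIdeal.span Γ.relations).proj.toLinearMap ∘ₗ preAdb)
    (fun t ht => (DGIdeal.span Γ.relations).proj_eq_zero.2
      (DGIdeal.subset_span Γ.relations (Or.inr (Or.inr ⟨t, ht, rfl⟩))))

theorem envInclΓ_lact (a b : 𝒜) :
    Γ.envInclΓ (Γ.lact a (Γ.d b)) = Γ.envIncl a * Γ.envelope.d (Γ.envIncl b) := by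
  have h := liftSurj_apply Γ.adb Γ.adb_surjective
    ((DGIdeal.span Γ.relations).proj.toLinearMap ∘ₗ preAdb)
    (fun t ht => (DGIdeal.span Γ.relations).proj_eq_zero.2
      (DGIdeal.subset_span Γ.relations (Or.inr (Or.inr ⟨t, ht, rfl⟩)))) (a ⊗ₜ b)
  refine h.trans ?_
  change (DGIdeal.span Γ.relations).proj (preInl a * (preEnvelope 𝒜).d (preInl b)) = _
  rw [map_mul, ← DGIdeal.dQ_proj]
  rfl

end BicovariantCalculus

namespace BicovariantCalculus

variable {𝒜 : Type u} [Ring 𝒜] [StarRing 𝒜] [HopfAlgebra ℂ 𝒜] [StarModule ℂ 𝒜]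
  (Γ : BicovariantCalculus 𝒜)

theorem preInl_mem (a : 𝒜) : preInl a ∈ (preEnvelope 𝒜).gr 0 := Free.gen_mem 0 (Sum.inl a)

theorem envIncl_mem (a : 𝒜) : Γ.envIncl a ∈ Γ.envelope.gr 0 :=
  (DGIdeal.span Γ.relations).proj_mem_gr (preInl_mem a)

theorem envInclΓ_mem (ξ : Γ.carrier) : Γ.envInclΓ ξ ∈ Γ.envelope.gr 1 := by
  obtain ⟨t, rfl⟩ := Γ.adb_surjective ξ
  induction t using TensorProduct.induction_on with
  | zero =>
    rw [LinearMap.map_zero, LinearMap.map_zero]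
    exact (Γ.envelope.gr 1).zero_mem
  | add x y h h' =>
    rw [LinearMap.map_add, LinearMap.map_add]
    exact (Γ.envelope.gr 1).add_mem h h'
  | tmul a b =>
    rw [adb_tmul, envInclΓ_lact]
    exact SetLike.GradedMul.mul_mem (A := Γ.envelope.gr) (i := 0) (j := 1) (Γ.envIncl_mem a)
      (Γ.envelope.d_mem 0 _ (Γ.envIncl_mem b))

end BicovariantCalculus

/-- A higher-order calculus on the quantum group extending the first-order calculus `Γ`: a
graded-differential *-algebra obtained from the universal envelope `Γ^∧` by factorizing through
a graded-differential *-ideal (the kernel of `proj`) which vanishes in degrees `0` and `1`. The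
two extreme cases are the envelope `Γ^∧` itself, and the braided exterior algebra `Γ^∨`. -/
structure HigherOrderCalculus {𝒜 : Type u} [Ring 𝒜] [StarRing 𝒜] [HopfAlgebra ℂ 𝒜]
    [StarModule ℂ 𝒜] (Γ : BicovariantCalculus 𝒜) where
  alg : GDSAlg.{u}
  proj : DGHom Γ.envelope alg
  proj_mem : ∀ n, ∀ x ∈ Γ.envelope.gr n, proj x ∈ alg.gr n
  proj_st : ∀ x, proj (Γ.envelope.st x) = alg.st (proj x)
  proj_surjective : Function.Surjective proj
  proj_injective : ∀ n ≤ 1, ∀ x ∈ Γ.envelope.gr n, proj x = 0 → x = 0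

namespace HigherOrderCalculus

variable {𝒜 : Type u} [Ring 𝒜] [StarRing 𝒜] [HopfAlgebra ℂ 𝒜] [StarModule ℂ 𝒜]
  {Γ : BicovariantCalculus 𝒜}

/-- The calculus described by the universal envelope `Γ^∧`. -/
def universal (Γ : BicovariantCalculus 𝒜) : HigherOrderCalculus Γ where
  alg := Γ.envelope
  proj := ⟨AlgHom.id ℂ _, fun _ => rfl⟩
  proj_mem _ _ h := h
  proj_st _ := rfl
  proj_surjective := Function.surjective_id
  proj_injective _ _ _ _ h := h

variable (C : HigherOrderCalculus Γ)

/-- The inclusion of `𝒜` as the component of degree zero. -/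
def incl : 𝒜 →ₐ[ℂ] C.alg := C.proj.toAlgHom.comp Γ.envIncl

/-- The inclusion of `Γ` as the component of degree one. -/
def inclΓ : Γ.carrier →ₗ[ℂ] C.alg := C.proj.toAlgHom.toLinearMap ∘ₗ Γ.envInclΓ

theorem incl_mem (a : 𝒜) : C.incl a ∈ C.alg.gr 0 := C.proj_mem 0 _ (Γ.envIncl_mem a)

theorem inclΓ_mem (ξ : Γ.carrier) : C.inclΓ ξ ∈ C.alg.gr 1 := C.proj_mem 1 _ (Γ.envInclΓ_mem ξ)

end HigherOrderCalculus

/-! ### The universal algebra `Ω` -/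

section Universal

variable {𝒜 : Type u} [Ring 𝒜] [StarRing 𝒜] [HopfAlgebra ℂ 𝒜] [StarModule ℂ 𝒜]
  [CompactMatrixQuantumGroup 𝒜]

/-- The algebra `Ω`, the universal differential envelope of the tensor algebra of `Γ_inv`: the
differential algebra freely generated by the space `Γ_inv` in degree one. -/
def Omega (Γ : BicovariantCalculus 𝒜) : GDSAlg.{u} := free Γ.inv Γ.invSt Γ.invSt_invSt 1

/-- The inclusion of `Γ_inv` into `Ω`. -/
def omegaIncl (Γ : BicovariantCalculus 𝒜) : Γ.inv →ₗ[ℂ] Omega Γ :=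
  TensorAlgebra.ι ℂ ∘ₗ LinearMap.inl ℂ Γ.inv Γ.inv

variable {Γ : BicovariantCalculus 𝒜} (C : HigherOrderCalculus Γ)

variable (Γ) in
/-- The generators `ϑ` and `dϑ` of `Ω`. -/
def omegaGen (g : Γ.inv ⊕ Γ.inv) : Omega Γ := Free.gen g

variable (Γ) in
theorem omegaGen_mem (g : Γ.inv ⊕ Γ.inv) : omegaGen Γ g ∈ (Omega Γ).gr (Free.wt 1 g) :=
  Free.gen_mem 1 g

variable (Γ) in
theorem omega_d_inl (v : Γ.inv) : (Omega Γ).d (omegaGen Γ (Sum.inl v)) = omegaGen Γ (Sum.inr v) :=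
  Free.d_inl 1 v

variable (Γ) in
theorem omega_d_inr (v : Γ.inv) : (Omega Γ).d (omegaGen Γ (Sum.inr v)) = 0 := Free.d_inr 1 v

theorem omega_gr_induction {p : ℕ → Omega Γ → Prop} (h0 : ∀ n, p n 0) (h1 : p 0 1)
    (hgen : ∀ g n x, p n x → p (Free.wt 1 g + n) (omegaGen Γ g * x))
    (hadd : ∀ n x y, p n x → p n y → p n (x + y))
    (hsmul : ∀ n (c : ℂ) x, p n x → p n (c • x)) (n : ℕ) (x : Omega Γ)
    (hx : x ∈ (Omega Γ).gr n) : p n x := by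
  refine Submodule.span_induction (p := fun x _ => p n x) ?_ (h0 n)
    (fun x y _ _ => hadd n x y) (fun c x _ => hsmul n c x) hx
  clear hx
  rintro _ ⟨l, rfl, rfl⟩
  induction l with
  | nil => exact h1
  | cons g l ih =>
    have h := hgen g _ _ ih
    simp only [List.map_cons, List.prod_cons, List.sum_cons]
    exact h

theorem omega_induction {p : Omega Γ → Prop} (h0 : p 0) (h1 : p 1)
    (hgen : ∀ g x, p x → p (omegaGen Γ g * x)) (hadd : ∀ x y, p x → p y → p (x + y))
    (hsmul : ∀ (c : ℂ) x, p x → p (c • x)) (x : Omega Γ) : p x :=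
  hom_induction (Omega Γ).gr (fun n x hx => omega_gr_induction (p := fun _ => p) (fun _ => h0) h1
    (fun g _ => hgen g) (fun _ => hadd) (fun _ => hsmul) n x hx) hadd x

/-- The element `ϖ(ϑ) + 1 ⊗ ϑ` of the graded tensor product of `Ω` and the calculus on `G`. -/
def adjGen : Γ.inv →ₗ[ℂ] (Omega Γ).gr ᵍ⊗[ℂ] C.alg.gr :=
  (GradedTensorProduct.of ℂ (Omega Γ).gr C.alg.gr).toLinearMap ∘ₗ
    (map (omegaIncl Γ) C.incl.toLinearMap ∘ₗ Γ.adj +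
      TensorProduct.mk ℂ (Omega Γ) C.alg 1 ∘ₗ C.inclΓ ∘ₗ Γ.inv.subtype)

/-- The algebra homomorphism with `ϑ ↦ ϖ(ϑ) + 1 ⊗ ϑ` and `dϑ ↦ d(ϖ(ϑ) + 1 ⊗ ϑ)`. -/
def adjTildeHom : Omega Γ →ₐ[ℂ] (Omega Γ).gr ᵍ⊗[ℂ] C.alg.gr :=
  TensorAlgebra.lift ℂ
    (LinearMap.coprod (adjGen C) (GDSAlg.tensorD (Omega Γ) C.alg ∘ₗ adjGen C))

theorem adjTildeHom_inl (v : Γ.inv) :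
    adjTildeHom C (omegaGen Γ (Sum.inl v)) = adjGen C v := by
  refine (TensorAlgebra.lift_ι_apply _ _).trans ?_
  simp

theorem adjTildeHom_inr (v : Γ.inv) :
    adjTildeHom C (omegaGen Γ (Sum.inr v)) = GDSAlg.tensorD (Omega Γ) C.alg (adjGen C v) := by
  refine (TensorAlgebra.lift_ι_apply _ _).trans ?_
  simp

theorem adjGen_mem (v : Γ.inv) : adjGen C v ∈ GDSAlg.tensorGr (Omega Γ) C.alg 1 := by
  have h1 : ∀ t : Γ.inv ⊗[ℂ] 𝒜, GradedTensorProduct.of ℂ (Omega Γ).gr C.alg.gr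
      (map (omegaIncl Γ) C.incl.toLinearMap t) ∈ GDSAlg.tensorGr (Omega Γ) C.alg 1 := by
    intro t
    induction t using TensorProduct.induction_on with
    | zero => simp
    | add x y h h' => rw [map_add, map_add]; exact add_mem h h'
    | tmul x y =>
      exact GDSAlg.tmul_mem (i := 1) (j := 0) (Free.gen_mem 1 (Sum.inl x)) (C.incl_mem y)
  have h2 : (1 : Omega Γ) ᵍ⊗ₜ[ℂ] (C.inclΓ v) ∈ GDSAlg.tensorGr (Omega Γ) C.alg 1 :=
    GDSAlg.tmul_mem (i := 0) (j := 1) (Omega Γ).one_mem (C.inclΓ_mem v)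
  exact add_mem (h1 _) h2

theorem adjTildeHom_gen_mem (g : Γ.inv ⊕ Γ.inv) :
    adjTildeHom C (omegaGen Γ g) ∈ GDSAlg.tensorGr (Omega Γ) C.alg (Free.wt 1 g) := by
  rcases g with v | v
  · rw [adjTildeHom_inl]; exact adjGen_mem C v
  · rw [adjTildeHom_inr]; exact GDSAlg.tensorD_mem (adjGen_mem C v)

theorem adjTildeHom_mem (n : ℕ) (x : Omega Γ) (hx : x ∈ (Omega Γ).gr n) :
    adjTildeHom C x ∈ GDSAlg.tensorGr (Omega Γ) C.alg n := by
  refine omega_gr_induction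
    (p := fun n x => adjTildeHom C x ∈ GDSAlg.tensorGr (Omega Γ) C.alg n) ?_ ?_ ?_ ?_ ?_ n x hx
  · intro n; rw [map_zero]; exact zero_mem _
  · rw [map_one]
    exact GDSAlg.tmul_mem (i := 0) (j := 0) (Omega Γ).one_mem C.alg.one_mem
  · intro g n x h
    rw [map_mul]
    exact GDSAlg.tensorGr_mul (adjTildeHom_gen_mem C g) h
  · intro n x y h h'; rw [map_add]; exact add_mem h h'
  · intro n c x h; rw [map_smul]; exact Submodule.smul_mem _ _ h

theorem adjTildeHom_d (x : Omega Γ) :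
    adjTildeHom C ((Omega Γ).d x) = GDSAlg.tensorD (Omega Γ) C.alg (adjTildeHom C x) := by
  refine omega_induction
    (p := fun x => adjTildeHom C ((Omega Γ).d x) = GDSAlg.tensorD _ _ (adjTildeHom C x))
    ?_ ?_ ?_ ?_ ?_ x
  · simp only [map_zero]
  · have h : adjTildeHom C 1 = (1 : Omega Γ) ᵍ⊗ₜ[ℂ] (1 : C.alg) := map_one _
    rw [h, (Omega Γ).d_one, GDSAlg.tensorD_tmul, (Omega Γ).d_one, C.alg.d_one, map_zero]
    simp [GradedTensorProduct.tmul]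
  · intro g x h
    have hg : adjTildeHom C ((Omega Γ).d (omegaGen Γ g)) =
        GDSAlg.tensorD _ _ (adjTildeHom C (omegaGen Γ g)) := by
      rcases g with v | v
      · rw [adjTildeHom_inl, ← adjTildeHom_inr, omega_d_inl]
      · rw [adjTildeHom_inr, GDSAlg.tensorD_tensorD, omega_d_inr, map_zero]
    rw [(Omega Γ).d_mul _ _ (omegaGen_mem Γ g) x, map_add, map_mul, map_smul, map_mul, map_mul,
      h, hg, GDSAlg.tensorD_mul (adjTildeHom_gen_mem C g) (adjTildeHom C x)]
  · intro x y h h'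
    simp only [map_add, h, h']
  · intro c x h
    simp only [map_smul, h]

/-- The coaction `ϖ~ : Ω → Ω ⊗̂ Γ^⋆`, the graded-differential homomorphism with
`ϖ~(ϑ) = ϖ(ϑ) + 1 ⊗ ϑ` for `ϑ ∈ Γ_inv`. -/
def adjTilde : DGCoaction (Omega Γ) C.alg where
  toAlgHom := adjTildeHom C
  map_mem := adjTildeHom_mem C
  map_d := adjTildeHom_d C

/-- The graded-differential subalgebra `ℸ` of `ϖ~`-invariant elements of `Ω`. -/
def daleth : DGSub (Omega Γ) := (adjTilde C).invariants

end Universal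

/-! ### Quantum principal bundles -/

/-- A quantum principal bundle `P = (ℬ, i, F)` over the quantum space represented by `𝒱`. -/
structure QuantumPrincipalBundle (𝒜 : Type u) [Ring 𝒜] [StarRing 𝒜] [HopfAlgebra ℂ 𝒜]
    [StarModule ℂ 𝒜] (𝒱 : Type v) [Ring 𝒱] [StarRing 𝒱] [Algebra ℂ 𝒱] [StarModule ℂ 𝒱]
    (ℬ : Type w) [Ring ℬ] [StarRing ℬ] [Algebra ℂ ℬ] [StarModule ℂ ℬ] where
  i : 𝒱 →⋆ₐ[ℂ] ℬ
  F : ℬ →ₐ[ℂ] ℬ ⊗[ℂ] 𝒜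
  F_star : ∀ b, F (star b) = star (F b)
  coassoc : ∀ b, TensorProduct.assoc ℂ ℬ 𝒜 𝒜 (F.toLinearMap.rTensor 𝒜 (F b)) =
    (comul (R := ℂ) (A := 𝒜)).lTensor ℬ (F b)
  counit : ∀ b, (Coalgebra.counit (R := ℂ) (A := 𝒜)).lTensor ℬ (F b) = b ⊗ₜ 1
  i_injective : Function.Injective i
  range_i : ∀ b, b ∈ Set.range i ↔ F b = b ⊗ₜ 1
  free : ∀ a : 𝒜, (1 : ℬ) ⊗ₜ[ℂ] a ∈
    Submodule.span ℂ {t : ℬ ⊗[ℂ] 𝒜 | ∃ q b : ℬ, t = (q ⊗ₜ 1) * F b}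

section Bundle

variable {𝒜 : Type u} [Ring 𝒜] [StarRing 𝒜] [HopfAlgebra ℂ 𝒜] [StarModule ℂ 𝒜]
  {𝒱 : Type v} [Ring 𝒱] [StarRing 𝒱] [Algebra ℂ 𝒱] [StarModule ℂ 𝒱]
  {ℬ : Type w} [Ring ℬ] [StarRing ℬ] [Algebra ℂ ℬ] [StarModule ℂ ℬ]
  {Γ : BicovariantCalculus 𝒜}

/-- A calculus `Ω(P)` on a quantum principal bundle `P`: a graded-differential *-algebra with
`Ω⁰(P) = ℬ`, generated by `ℬ` as a differential algebra, such that the right action `F` extends to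
a graded-differential *-homomorphism `F^ : Ω(P) → Ω(P) ⊗̂ Γ^⋆`. -/
structure BundleCalculus (P : QuantumPrincipalBundle 𝒜 𝒱 ℬ) (C : HigherOrderCalculus Γ) where
  Ω : GDSAlg.{w}
  incl : ℬ →ₐ[ℂ] Ω
  incl_star : ∀ b, incl (star b) = Ω.st (incl b)
  incl_injective : Function.Injective incl
  range_incl : ∀ x, x ∈ Set.range incl ↔ x ∈ Ω.gr 0
  generates : Algebra.adjoin ℂ (Set.range incl ∪ Set.range (fun b => Ω.d (incl b))) = ⊤
  Fhat : DGCoaction Ω C.alg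
  Fhat_incl : ∀ b, Fhat (incl b) =
    GradedTensorProduct.of ℂ Ω.gr C.alg.gr (map incl.toLinearMap C.incl.toLinearMap (P.F b))
  Fhat_st : ∀ x, Fhat (Ω.st x) = GDSAlg.tensorSt Ω C.alg (Fhat x)

variable {P : QuantumPrincipalBundle 𝒜 𝒱 ℬ} {C : HigherOrderCalculus Γ}

/-- The algebra `Ω(M)` of differential forms on the base: the `F^`-invariant forms on the bundle. -/
def BundleCalculus.baseForms (Q : BundleCalculus P C) : DGSub Q.Ω := Q.Fhat.invariants

/-- A connection: a hermitian map `ω : Γ_inv → Ω¹(P)` with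
`F^ ω(ϑ) = (ω ⊗ id)ϖ(ϑ) + 1 ⊗ ϑ`. -/
structure Connection [CompactMatrixQuantumGroup 𝒜] (Q : BundleCalculus P C) where
  form : Γ.inv →ₗ[ℂ] Q.Ω
  form_mem : ∀ ϑ, form ϑ ∈ Q.Ω.gr 1
  form_st : ∀ ϑ, form (Γ.invSt ϑ) = Q.Ω.st (form ϑ)
  Fhat_form : ∀ ϑ : Γ.inv, Q.Fhat (form ϑ) =
    GradedTensorProduct.of ℂ Q.Ω.gr C.alg.gr (map form C.incl.toLinearMap (Γ.adj ϑ)) +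
      (1 : Q.Ω) ᵍ⊗ₜ[ℂ] C.inclΓ ϑ

/-- The homomorphism `f : Ω → Ω(P)` of differential algebras extends the connection `ω`. -/
def Connection.ExtendsTo [CompactMatrixQuantumGroup 𝒜] {Q : BundleCalculus P C}
    (ω : Connection Q) (f : DGHom (Omega Γ) Q.Ω) : Prop :=
  ∀ ϑ, f (omegaIncl Γ ϑ) = ω.form ϑ

/-- The linear map `L : Ω → Ω(P)` is given by `L(1) = 0`, `L(ϑ) = 0`, `L(dϑ) = ω(ϑ) - τ(ϑ)` and
`L(wu) = L(w) g(u) + (-1)^∂w f(w) L(u)`, where `f` and `g` are the extensions of `ω` and `τ`. -/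
structure IsHomotopy [CompactMatrixQuantumGroup 𝒜] {Q : BundleCalculus P C} (ω τ : Connection Q)
    (f g : DGHom (Omega Γ) Q.Ω) (L : Omega Γ →ₗ[ℂ] Q.Ω) : Prop where
  map_one : L 1 = 0
  map_incl : ∀ ϑ, L (omegaIncl Γ ϑ) = 0
  map_d_incl : ∀ ϑ, L ((Omega Γ).d (omegaIncl Γ ϑ)) = ω.form ϑ - τ.form ϑ
  map_mul : ∀ n, ∀ w ∈ (Omega Γ).gr n, ∀ u,
    L (w * u) = L w * g u + (-1 : ℂ) ^ n • (f w * L u)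

end Bundle

end QPB

end

open QPB

/-! The algebra `Omega Γ` is free, namely the tensor algebra on `Γ_inv ⊕ dΓ_inv`, so a homomorphism
of differential algebras out of it is given by an arbitrary linear map on `Γ_inv`: the value on `dϑ`
is forced to be the differential of the value on `ϑ`. This gives existence and uniqueness of the
extension of a connection. Its compatibility with degree, involution and coaction is checked on
generators and propagated along words. For the coaction, the check on `ϑ` is exactly the defining
identity of a connection, and the check on `dϑ` follows because both sides commute with the
differentials (`Connection.Fhat_extension`).

For two connections with extensions `f` and `g`, the homotopy `L` is a derivation of degree `-1`
twisted by `f` and `g`. Freeness produces only algebra homomorphisms, so `L` is obtained as the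
corner entry of a homomorphism into upper triangular 2×2 matrices, with `f` composed with parity,
and `g`, on the diagonal (`omegaTwistedMat`).

Every identity about `L` then has the same proof: both sides are twisted derivations along the same
pair of maps, hence are equal once they agree on generators (`omega_twisted_ext`). For `f - g = Ld +
dL` the right side is a graded commutator of `L` with the differentials, and its cross terms cancel
(`IsHomotopy.sub_eq`). For the coaction, `L ⊗ id` is again a twisted derivation of the graded tensor
products (`GDSAlg.tensorMapLeft_twisted`), and the inhomogeneous terms `1 ⊗ ϑ` cancel in the
difference of two connections (`IsHomotopy.Fhat_map`).

Intertwining maps preserve coinvariants, so `L` sends `daleth C` into the base forms. The homotopy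
therefore restricts to the invariant subcomplexes, and the two maps in cohomology coincide. -/

namespace QPB

open TensorProduct

noncomputable section

/-! ### Maps `f ⊗ id` on graded tensor products. -/

namespace GDSAlg

variable {A : GDSAlg.{u}} {B : GDSAlg.{v}} {C : GDSAlg.{w}}

theorem st_one (A : GDSAlg.{u}) : A.st 1 = 1 := by
  have h := A.st_mul 0 0 1 A.one_mem (A.st 1) (A.st_mem 0 1 A.one_mem)
  rw [one_mul, A.st_st] at h
  simpa using h.symm

theorem tensorMapLeft_tmul (f : A →ₗ[ℂ] B) (a : A) (c : C) :
    tensorMapLeft C f (a ᵍ⊗ₜ[ℂ] c) = (f a) ᵍ⊗ₜ[ℂ] c := by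
  simp [tensorMapLeft]

theorem tensorMapLeft_of (f : A →ₗ[ℂ] B) (t : A ⊗[ℂ] C) :
    tensorMapLeft C f (GradedTensorProduct.of ℂ A.gr C.gr t) =
      GradedTensorProduct.of ℂ B.gr C.gr (map f LinearMap.id t) := by
  simp [tensorMapLeft]

theorem tensorMapLeft_one (f : A →ₐ[ℂ] B) :
    tensorMapLeft C f.toLinearMap (1 : A.gr ᵍ⊗[ℂ] C.gr) = 1 := by
  refine (tensorMapLeft_tmul f.toLinearMap (1 : A) (1 : C)).trans ?_
  rw [AlgHom.toLinearMap_apply, map_one]; rfl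

/-- A twisted derivation `L` of degree `-1` along degree preserving homomorphisms `f` and `g` induces
a twisted derivation `L ⊗ id` of the graded tensor products. -/
theorem tensorMapLeft_twisted {f g : A →ₐ[ℂ] B} {L : A →ₗ[ℂ] B}
    (hg : ∀ n, ∀ x ∈ A.gr n, g x ∈ B.gr n)
    (hL : ∀ n, ∀ w ∈ A.gr n, ∀ u, L (w * u) = L w * g u + (-1 : ℂ) ^ n • (f w * L u))
    (hL0 : ∀ x ∈ A.gr 0, L x = 0) (hLs : ∀ n, ∀ x ∈ A.gr (n + 1), L x ∈ B.gr n)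
    {n : ℕ} {x : A.gr ᵍ⊗[ℂ] C.gr} (hx : x ∈ tensorGr A C n) (y : A.gr ᵍ⊗[ℂ] C.gr) :
    tensorMapLeft C L (x * y) =
      tensorMapLeft C L x * tensorMapLeft C g.toLinearMap y +
        (-1 : ℂ) ^ n • (tensorMapLeft C f.toLinearMap x * tensorMapLeft C L y) := by
  induction hx using Submodule.span_induction with
  | zero => simp
  | add x x' _ _ h h' => simp only [add_mul, map_add, smul_add, h, h']; abel
  | smul c x _ h => simp only [smul_mul_assoc, map_smul, h, smul_add]; rw [smul_comm]
  | mem x hx =>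
    obtain ⟨i, j, rfl, a, ha, b, hb, rfl⟩ := hx
    refine tensor_induction (p := fun y => tensorMapLeft C L (a ᵍ⊗ₜ[ℂ] b * y) =
      tensorMapLeft C L (a ᵍ⊗ₜ[ℂ] b) * tensorMapLeft C g.toLinearMap y +
        (-1 : ℂ) ^ (i + j) •
          (tensorMapLeft C f.toLinearMap (a ᵍ⊗ₜ[ℂ] b) * tensorMapLeft C L y)) ?_ ?_ y
    · intro i' j' a' ha' b' _
      rw [tmul_mul_tmul a hb ha' b', map_smul]
      simp only [tensorMapLeft_tmul, AlgHom.toLinearMap_apply]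
      rw [hL i a ha, tmul_mul_tmul _ hb (hg i' a' ha')]
      -- The Koszul sign of the second product depends on the degree of `L a'`, which is one less
      -- than that of `a'`. In degree zero there is no such degree, but `L a'` vanishes. Otherwise
      -- the exponents `j(k+1) + i` and `(i+j) + jk` agree: the `j` lost in the Koszul sign is
      -- supplied by the total degree `i + j`.
      rcases i' with _ | k
      · rw [hL0 a' ha']
        simp [GradedTensorProduct.tmul]
      · rw [tmul_mul_tmul _ hb (hLs k a' ha')]
        simp only [GradedTensorProduct.tmul, TensorProduct.add_tmul, map_add,
          ← TensorProduct.smul_tmul', map_smul, smul_add, smul_smul]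
        congr 2
        have : (-1 : ℂ) ^ (j + j) = 1 := (Even.add_self j).neg_one_pow
        rw [← pow_add, ← pow_add, show j * (k + 1) + i = j * k + (i + j) by ring]
        congr 1; ring
    · intro x y hx hy
      simp only [mul_add, map_add, hx, hy, smul_add]; abel

/-- The sign in the graded product depends on the degree of the second left factor, so preservation
of degree is what makes `f ⊗ id` multiplicative. -/
theorem tensorMapLeft_mul {f : A →ₐ[ℂ] B} (hf : ∀ n, ∀ x ∈ A.gr n, f x ∈ B.gr n)
    (x y : A.gr ᵍ⊗[ℂ] C.gr) :
    tensorMapLeft C f.toLinearMap (x * y) =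
      tensorMapLeft C f.toLinearMap x * tensorMapLeft C f.toLinearMap y := by
  refine tensor_induction (p := fun x => tensorMapLeft C f.toLinearMap (x * y) =
    tensorMapLeft C f.toLinearMap x * tensorMapLeft C f.toLinearMap y) ?_ ?_ x
  · intro i j a ha b hb
    refine tensor_induction (p := fun y => tensorMapLeft C f.toLinearMap (a ᵍ⊗ₜ[ℂ] b * y) =
      tensorMapLeft C f.toLinearMap (a ᵍ⊗ₜ[ℂ] b) * tensorMapLeft C f.toLinearMap y) ?_ ?_ y
    · intro i' j' a' ha' b' _
      rw [tmul_mul_tmul a hb ha' b', map_smul]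
      simp only [tensorMapLeft_tmul, AlgHom.toLinearMap_apply]
      rw [tmul_mul_tmul _ hb (hf i' a' ha'), map_mul]
    · intro x y hx hy
      simp only [mul_add, map_add, hx, hy]
  · intro x x' hx hx'
    simp only [add_mul, map_add, hx, hx']

/-- The second summand of the tensor differential contains the parity operator, with which `f`
commutes because it preserves degree; the first summand is handled by `hd`. -/
theorem tensorMapLeft_tensorD {f : A →ₐ[ℂ] B} (hf : ∀ n, ∀ x ∈ A.gr n, f x ∈ B.gr n)
    (hd : ∀ x, f (A.d x) = B.d (f x)) (x : A.gr ᵍ⊗[ℂ] C.gr) :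
    tensorMapLeft C f.toLinearMap (tensorD A C x) =
      tensorD B C (tensorMapLeft C f.toLinearMap x) := by
  refine tensor_induction (p := fun x => tensorMapLeft C f.toLinearMap (tensorD A C x) =
      tensorD B C (tensorMapLeft C f.toLinearMap x)) ?_ ?_ x
  · intro i j a ha b hb
    simp only [tensorD_tmul, map_add, tensorMapLeft_tmul, AlgHom.toLinearMap_apply, hd,
      parity_apply ha, parity_apply (hf i a ha), map_smul]
  · intro x y hx hy
    simp only [map_add, hx, hy]

end GDSAlg

/-! ### Passage to coinvariants and to cohomology. -/

/-- An element of the coinvariants is mapped to coinvariants by every linear map intertwining the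
coactions. -/
theorem DGCoaction.mem_invariants_of_intertwines {A : GDSAlg.{u}} {B : GDSAlg.{v}}
    {C : GDSAlg.{w}} {Φ : DGCoaction A C} {Ψ : DGCoaction B C} {f : A →ₗ[ℂ] B}
    (h : ∀ x, Ψ (f x) = GDSAlg.tensorMapLeft C f (Φ x)) {x : A} (hx : x ∈ Φ.invariants) :
    f x ∈ Ψ.invariants := by
  rw [DGCoaction.mem_invariants] at hx ⊢
  rw [h, hx, GDSAlg.tensorMapLeft_tmul]

/-- Homotopic homomorphisms induce the same map in cohomology. -/
theorem DGSub.cohomologyMap_eq_of_homotopy {A : GDSAlg.{u}} {B : GDSAlg.{v}} {K : DGSub A}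
    {K' : DGSub B} {f g : DGHom A B} (hf : ∀ x ∈ K, f x ∈ K') (hg : ∀ x ∈ K, g x ∈ K')
    (L : A →ₗ[ℂ] B) (hL : ∀ x, f x - g x = L (A.d x) + B.d (L x)) (hLK : ∀ x ∈ K, L x ∈ K') :
    DGSub.cohomologyMap f hf = DGSub.cohomologyMap g hg := by
  refine AlgHom.ext fun y => ?_
  obtain ⟨x, rfl⟩ := Ideal.Quotient.mk_surjective y
  refine Ideal.Quotient.eq.2 ?_
  -- On a cocycle the term `L (d x)` drops out, so `L x` is a primitive of the difference. That it
  -- lies in `K'` is essential, since cohomology is taken inside `K'`.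
  refine ⟨L x, hLK x x.2.1, ?_⟩
  have h := hL x
  rw [x.2.2, map_zero, zero_add] at h
  exact h.symm

/-! ### Homomorphisms out of the free differential algebra. -/

section Universal

variable {𝒜 : Type u} [Ring 𝒜] [StarRing 𝒜] [HopfAlgebra ℂ 𝒜] [StarModule ℂ 𝒜]
  [CompactMatrixQuantumGroup 𝒜] {Γ : BicovariantCalculus 𝒜} {B : GDSAlg.{v}}

/-- The reversal sign occurs twice, once in `Free.rev` on a generator and once in `Free.st`, and
squares to one. -/
theorem omega_st_gen (g : Γ.inv ⊕ Γ.inv) :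
    (Omega Γ).st (omegaGen Γ g) = omegaGen Γ (Sum.map Γ.invSt Γ.invSt g) := by
  refine (Free.st_apply Γ.invSt (Free.gen_mem 1 g)).trans ?_
  rw [Free.rev_gen, smul_smul, Free.sgn_mul_self, one_smul]; rfl

/-- Two twisted derivations on `Ω` agreeing on generators are equal. -/
theorem omega_twisted_ext {R : Type*} [Ring R] [Algebra ℂ R] {f g : Omega Γ →ₗ[ℂ] R}
    {H H' : Omega Γ →ₗ[ℂ] R} (h1 : H 1 = H' 1)
    (hgen : ∀ s, H (omegaGen Γ s) = H' (omegaGen Γ s))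
    (hH : ∀ s u, H (omegaGen Γ s * u) =
      H (omegaGen Γ s) * g u + f (omegaGen Γ s) * H u)
    (hH' : ∀ s u, H' (omegaGen Γ s * u) =
      H' (omegaGen Γ s) * g u + f (omegaGen Γ s) * H' u) (x : Omega Γ) : H x = H' x := by
  refine omega_induction (p := fun x => H x = H' x) ?_ h1 ?_ ?_ ?_ x
  · simp only [map_zero]
  · intro s x h
    rw [hH, hH', h, hgen]
  · intro x y h h'
    simp only [map_add, h, h']
  · intro c x h
    simp only [map_smul, h]

/-- The homomorphism of differential algebras determined by a linear map on `Γ_inv`. -/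
def omegaLiftHom (φ : Γ.inv →ₗ[ℂ] B) : Omega Γ →ₐ[ℂ] B :=
  TensorAlgebra.lift ℂ (LinearMap.coprod φ (B.d ∘ₗ φ))

theorem omegaLiftHom_inl (φ : Γ.inv →ₗ[ℂ] B) (v : Γ.inv) :
    omegaLiftHom φ (omegaGen Γ (Sum.inl v)) = φ v := by
  refine (TensorAlgebra.lift_ι_apply _ _).trans ?_
  simp

theorem omegaLiftHom_inr (φ : Γ.inv →ₗ[ℂ] B) (v : Γ.inv) :
    omegaLiftHom φ (omegaGen Γ (Sum.inr v)) = B.d (φ v) := by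
  refine (TensorAlgebra.lift_ι_apply _ _).trans ?_
  simp

theorem omegaLiftHom_gen_mem {φ : Γ.inv →ₗ[ℂ] B} (hφ : ∀ v, φ v ∈ B.gr 1) (s : Γ.inv ⊕ Γ.inv) :
    omegaLiftHom φ (omegaGen Γ s) ∈ B.gr (Free.wt 1 s) := by
  rcases s with v | v
  · rw [omegaLiftHom_inl]; exact hφ v
  · rw [omegaLiftHom_inr]; exact B.d_mem 1 _ (hφ v)

theorem omegaLiftHom_mem {φ : Γ.inv →ₗ[ℂ] B} (hφ : ∀ v, φ v ∈ B.gr 1) (n : ℕ) (x : Omega Γ)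
    (hx : x ∈ (Omega Γ).gr n) : omegaLiftHom φ x ∈ B.gr n := by
  refine omega_gr_induction (p := fun n x => omegaLiftHom φ x ∈ B.gr n) ?_ ?_ ?_ ?_ ?_ n x hx
  · intro n; rw [map_zero]; exact zero_mem _
  · rw [map_one]; exact B.one_mem
  · intro s n x h
    rw [map_mul]
    exact SetLike.GradedMul.mul_mem (omegaLiftHom_gen_mem hφ s) h
  · intro n x y h h'; rw [map_add]; exact add_mem h h'
  · intro n c x h; rw [map_smul]; exact Submodule.smul_mem _ _ h

/-- Prepending a generator expands both sides by the Leibniz rule with the same sign, because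
generators keep their degree. It remains to compare on generators: on `ϑ` this is the choice of the
lift on `dϑ`, and on `dϑ` both sides vanish since the differentials square to zero. -/
theorem omegaLiftHom_d {φ : Γ.inv →ₗ[ℂ] B} (hφ : ∀ v, φ v ∈ B.gr 1) (x : Omega Γ) :
    omegaLiftHom φ ((Omega Γ).d x) = B.d (omegaLiftHom φ x) := by
  refine omega_induction (p := fun x => omegaLiftHom φ ((Omega Γ).d x) = B.d (omegaLiftHom φ x))
    ?_ ?_ ?_ ?_ ?_ x
  · simp only [map_zero]
  · rw [(Omega Γ).d_one, map_zero, map_one, B.d_one]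
  · intro s x h
    have hs : omegaLiftHom φ ((Omega Γ).d (omegaGen Γ s)) = B.d (omegaLiftHom φ (omegaGen Γ s)) := by
      rcases s with v | v
      · rw [omegaLiftHom_inl, ← omegaLiftHom_inr, omega_d_inl]
      · rw [omegaLiftHom_inr, B.d_d, omega_d_inr, map_zero]
    rw [(Omega Γ).d_mul _ _ (omegaGen_mem Γ s) x, map_add, map_mul, map_smul, map_mul, map_mul,
      h, hs, B.d_mul _ _ (omegaLiftHom_gen_mem hφ s)]
  · intro x y h h'
    simp only [map_add, h, h']
  · intro c x h
    simp only [map_smul, h]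

theorem omegaLiftHom_st {φ : Γ.inv →ₗ[ℂ] B} (hφ : ∀ v, φ v ∈ B.gr 1)
    (hst : ∀ v, φ (Γ.invSt v) = B.st (φ v)) (x : Omega Γ) :
    omegaLiftHom φ ((Omega Γ).st x) = B.st (omegaLiftHom φ x) := by
  refine hom_induction (Omega Γ).gr
    (p := fun x => omegaLiftHom φ ((Omega Γ).st x) = B.st (omegaLiftHom φ x)) ?_ ?_ x
  · intro n x hx
    -- Membership of `x` in its degree is part of the induction hypothesis: the sign in graded
    -- antimultiplicativity involves the degrees of both factors, in the source and in the target.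
    refine (omega_gr_induction (p := fun n x => x ∈ (Omega Γ).gr n ∧
      omegaLiftHom φ ((Omega Γ).st x) = B.st (omegaLiftHom φ x)) ?_ ?_ ?_ ?_ ?_ n x hx).2
    · intro n
      exact ⟨zero_mem _, by simp only [map_zero]⟩
    · refine ⟨(Omega Γ).one_mem, ?_⟩
      rw [GDSAlg.st_one, map_one, GDSAlg.st_one]
    · rintro s n x ⟨hx, h⟩
      refine ⟨SetLike.GradedMul.mul_mem (omegaGen_mem Γ s) hx, ?_⟩
      have hs : omegaLiftHom φ ((Omega Γ).st (omegaGen Γ s)) =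
          B.st (omegaLiftHom φ (omegaGen Γ s)) := by
        rw [omega_st_gen]
        rcases s with v | v
        · rw [Sum.map_inl, omegaLiftHom_inl, omegaLiftHom_inl, hst]
        · rw [Sum.map_inr, omegaLiftHom_inr, omegaLiftHom_inr, hst, B.st_d]
      rw [(Omega Γ).st_mul _ _ _ (omegaGen_mem Γ s) _ hx, map_smul, map_mul, map_mul, h, hs,
        B.st_mul _ _ _ (omegaLiftHom_gen_mem hφ s) _ (omegaLiftHom_mem hφ n x hx)]
    · rintro n x y ⟨hx, h⟩ ⟨hy, h'⟩
      exact ⟨add_mem hx hy, by simp only [map_add, h, h']⟩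
    · rintro n c x ⟨hx, h⟩
      exact ⟨Submodule.smul_mem _ _ hx, by simp only [map_smul, LinearMap.map_smulₛₗ, h]⟩
  · intro x y h h'
    simp only [map_add, h, h']

/-- Compatibility with the differential leaves no freedom on the generators `dϑ`. This gives the
uniqueness half of the universal property. -/
theorem DGHom.toAlgHom_eq_omegaLiftHom (f : DGHom (Omega Γ) B) {φ : Γ.inv →ₗ[ℂ] B}
    (h : ∀ v, f (omegaIncl Γ v) = φ v) : f.toAlgHom = omegaLiftHom φ := by
  have hl : ∀ v, f.toAlgHom (omegaGen Γ (Sum.inl v)) = φ v := h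
  refine AlgHom.ext fun x => ?_
  refine omega_induction (p := fun x => f.toAlgHom x = omegaLiftHom φ x) ?_ ?_ ?_ ?_ ?_ x
  · simp only [map_zero]
  · simp only [map_one]
  · intro s x h
    rw [map_mul, map_mul, h]
    rcases s with v | v
    · rw [hl, omegaLiftHom_inl]
    · rw [← omega_d_inl, f.map_d, hl, omega_d_inl, omegaLiftHom_inr]
  · intro x y h h'; simp only [map_add, h, h']
  · intro c x h; simp only [map_smul, h]

/-! ### Twisted derivations from triangular matrices. -/

/-- The matrix homomorphism `x ↦ !![f (parity x), L x; 0, g x]` encoding the twisted derivation `L`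
along `f` and `g` with `L ϑ = 0` and `L dϑ = δ ϑ`. -/
def omegaTwistedMat (f g : Omega Γ →ₐ[ℂ] B) (δ : Γ.inv →ₗ[ℂ] B) :
    Omega Γ →ₐ[ℂ] Matrix (Fin 2) (Fin 2) B :=
  TensorAlgebra.lift ℂ
    -- The corner entry reads only the second coordinate of `v`, the coefficient of `dϑ`; hence `L`
    -- kills `ϑ` itself.
    { toFun := fun v => !![f (Free.par 1 (TensorAlgebra.ι ℂ v)), δ v.2;
        0, g (TensorAlgebra.ι ℂ v)]
      map_add' := by
        intro x y
        rw [map_add (TensorAlgebra.ι ℂ), map_add (Free.par 1), Prod.snd_add]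
        ext i j
        fin_cases i <;> fin_cases j
        · exact map_add f _ _
        · exact map_add δ _ _
        · exact (add_zero 0).symm
        · exact map_add g _ _
      map_smul' := by
        intro c x
        rw [map_smul (TensorAlgebra.ι ℂ), map_smul (Free.par 1), Prod.smul_snd]
        ext i j
        fin_cases i <;> fin_cases j
        · exact map_smul f _ _
        · exact map_smul δ _ _
        · exact (smul_zero c).symm
        · exact map_smul g _ _ }

variable (f g : Omega Γ →ₐ[ℂ] B) (δ : Γ.inv →ₗ[ℂ] B)

theorem omegaTwistedMat_gen (s : Γ.inv ⊕ Γ.inv) :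
    omegaTwistedMat f g δ (omegaGen Γ s) =
      !![(-1 : ℂ) ^ Free.wt 1 s • f (omegaGen Γ s), Sum.elim (fun _ => 0) δ s; 0, g (omegaGen Γ s)] := by
  have hp : f (Free.par 1 (Free.gen s)) = (-1 : ℂ) ^ Free.wt 1 s • f (omegaGen Γ s) :=
    (congrArg f (Free.par_gen 1 s)).trans (map_smul f _ _)
  rcases s with v | v
  · refine (TensorAlgebra.lift_ι_apply _ _).trans ?_
    ext i j
    fin_cases i <;> fin_cases j
    · exact hp
    · exact map_zero δ
    · rfl
    · rfl
  · refine (TensorAlgebra.lift_ι_apply _ _).trans ?_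
    ext i j
    fin_cases i <;> fin_cases j
    · exact hp
    · rfl
    · rfl
    · rfl

/-- Upper triangular matrices are closed under multiplication and their diagonal entries multiply
separately, so the values on generators determine the diagonal. -/
theorem omegaTwistedMat_apply {n : ℕ} {x : Omega Γ} (hx : x ∈ (Omega Γ).gr n) :
    omegaTwistedMat f g δ x 0 0 = (-1 : ℂ) ^ n • f x ∧ omegaTwistedMat f g δ x 1 0 = 0 ∧
      omegaTwistedMat f g δ x 1 1 = g x := by
  refine omega_gr_induction (p := fun n x => omegaTwistedMat f g δ x 0 0 = (-1 : ℂ) ^ n • f x ∧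
    omegaTwistedMat f g δ x 1 0 = 0 ∧ omegaTwistedMat f g δ x 1 1 = g x) ?_ ?_ ?_ ?_ ?_ n x hx
  · intro n; simp only [map_zero, Matrix.zero_apply, smul_zero, and_self]
  · simp only [map_one]; simp
  · rintro s n x ⟨h, h', h''⟩
    simp only [map_mul, Matrix.mul_apply, Fin.sum_univ_two, h, h', h'', omegaTwistedMat_gen]
    simp [pow_add, smul_smul, mul_comm]
  · rintro n x y ⟨h, h', h''⟩ ⟨k, k', k''⟩
    simp only [map_add, Matrix.add_apply, h, h', h'', k, k', k'', smul_add, add_zero, and_self]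
  · rintro n c x ⟨h, h', h''⟩
    refine ⟨?_, ?_, ?_⟩
    · simp only [map_smul, Matrix.smul_apply, h]; rw [smul_comm]
    · simp only [map_smul, Matrix.smul_apply, h', smul_zero]
    · simp only [map_smul, Matrix.smul_apply, h'']

/-- The twisted derivation `L` along `f` and `g` with `L ϑ = 0` and `L dϑ = δ ϑ`. -/
def omegaTwisted : Omega Γ →ₗ[ℂ] B where
  toFun x := omegaTwistedMat f g δ x 0 1
  map_add' x y := by rw [map_add]; rfl
  map_smul' c x := by rw [map_smul]; rfl

theorem omegaTwisted_gen (s : Γ.inv ⊕ Γ.inv) :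
    omegaTwisted f g δ (omegaGen Γ s) = Sum.elim (fun _ => 0) δ s := by
  change omegaTwistedMat f g δ (omegaGen Γ s) 0 1 = _
  rw [omegaTwistedMat_gen]; simp

theorem omegaTwisted_one : omegaTwisted f g δ 1 = 0 := by
  change omegaTwistedMat f g δ 1 0 1 = 0
  rw [map_one]; simp

/-- The corner entry of a product of upper triangular matrices is `a₀₀ b₀₁ + a₀₁ b₁₁`; this is the
twisted Leibniz rule, with the sign coming from the parity built into the upper diagonal entry. -/
theorem omegaTwisted_mul (n : ℕ) (x : Omega Γ) (hx : x ∈ (Omega Γ).gr n) (y : Omega Γ) :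
    omegaTwisted f g δ (x * y) =
      omegaTwisted f g δ x * g y + (-1 : ℂ) ^ n • (f x * omegaTwisted f g δ y) := by
  -- The lower diagonal entry carries no sign, so its formula extends additively to inhomogeneous
  -- `y`.
  have hy : omegaTwistedMat f g δ y 1 1 = g y := by
    refine hom_induction (Omega Γ).gr (p := fun y => omegaTwistedMat f g δ y 1 1 = g y)
      (fun n y hy => (omegaTwistedMat_apply f g δ hy).2.2) ?_ y
    intro x y h h'
    simp only [map_add, Matrix.add_apply, h, h']
  change omegaTwistedMat f g δ (x * y) 0 1 = omegaTwistedMat f g δ x 0 1 * g y +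
    (-1 : ℂ) ^ n • (f x * omegaTwistedMat f g δ y 0 1)
  rw [map_mul, Matrix.mul_apply, Fin.sum_univ_two, hy, (omegaTwistedMat_apply f g δ hx).1,
    smul_mul_assoc, add_comm]

variable {f g δ}

/-- A twisted derivation with `L 1 = 0` that kills `Γ_inv` and maps `dΓ_inv` into degree one is of
degree `-1`. -/
theorem omega_twisted_degree {L : Omega Γ →ₗ[ℂ] B}
    (hf : ∀ n, ∀ x ∈ (Omega Γ).gr n, f x ∈ B.gr n) (hg : ∀ n, ∀ x ∈ (Omega Γ).gr n, g x ∈ B.gr n)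
    (h1 : L 1 = 0) (hgen : ∀ s, L (omegaGen Γ s) = Sum.elim (fun _ => 0) δ s) (hδ : ∀ v, δ v ∈ B.gr 1)
    (hL : ∀ n, ∀ w ∈ (Omega Γ).gr n, ∀ u, L (w * u) = L w * g u + (-1 : ℂ) ^ n • (f w * L u))
    (n : ℕ) (x : Omega Γ) (hx : x ∈ (Omega Γ).gr n) :
    (n = 0 → L x = 0) ∧ ∀ m, n = m + 1 → L x ∈ B.gr m := by
  refine (omega_gr_induction (p := fun n x => x ∈ (Omega Γ).gr n ∧
    (n = 0 → L x = 0) ∧ ∀ m, n = m + 1 → L x ∈ B.gr m) ?_ ?_ ?_ ?_ ?_ n x hx).2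
  · intro n
    exact ⟨zero_mem _, fun _ => map_zero L, fun m _ => by rw [map_zero]; exact zero_mem _⟩
  · exact ⟨(Omega Γ).one_mem, fun _ => h1, fun m h => by omega⟩
  · rintro s n x ⟨hx, h0, hs⟩
    refine ⟨SetLike.GradedMul.mul_mem (omegaGen_mem Γ s) hx, ?_, ?_⟩
    -- Generators have degree one or two, so a word starting with one never has degree zero.
    · intro h
      rcases s with v | v <;> simp [Free.wt] at h
    · intro m hm
      rw [hL _ _ (omegaGen_mem Γ s)]
      refine add_mem ?_ (Submodule.smul_mem _ _ ?_)
      · rw [hgen]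
        rcases s with v | v
        · simp
        -- The generator `dϑ` has degree two and `δ v` has degree one, so the first Leibniz term has
        -- lost exactly one degree.
        · have : m = 1 + n := by simp only [Free.wt] at hm; omega
          rw [this]
          exact SetLike.GradedMul.mul_mem (hδ v) (hg n x hx)
      -- In the second term the degree is lost by `x`; if `x` has degree zero there is nothing to
      -- lose, and `L x` is zero.
      · rcases n with _ | k
        · rw [h0 rfl, mul_zero]; exact zero_mem _
        · have : m = Free.wt 1 s + k := by omega
          rw [this]
          exact SetLike.GradedMul.mul_mem (hf _ _ (omegaGen_mem Γ s)) (hs k rfl)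
  · rintro n x y ⟨hx, h, h'⟩ ⟨hy, k, k'⟩
    refine ⟨add_mem hx hy, fun e => ?_, fun m e => ?_⟩
    · rw [map_add, h e, k e, add_zero]
    · rw [map_add]; exact add_mem (h' m e) (k' m e)
  · rintro n c x ⟨hx, h, h'⟩
    refine ⟨Submodule.smul_mem _ _ hx, fun e => ?_, fun m e => ?_⟩
    · rw [map_smul, h e, smul_zero]
    · rw [map_smul]; exact Submodule.smul_mem _ _ (h' m e)

end Universal

/-! ### The coaction on generators and `L ⊗ id`. -/

section Bundle

variable {𝒜 : Type u} [Ring 𝒜] [StarRing 𝒜] [HopfAlgebra ℂ 𝒜] [StarModule ℂ 𝒜]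
  [CompactMatrixQuantumGroup 𝒜]
  {𝒱 : Type v} [Ring 𝒱] [StarRing 𝒱] [Algebra ℂ 𝒱] [StarModule ℂ 𝒱]
  {ℬ : Type w} [Ring ℬ] [StarRing ℬ] [Algebra ℂ ℬ] [StarModule ℂ ℬ]
  {Γ : BicovariantCalculus 𝒜} {P : QuantumPrincipalBundle 𝒜 𝒱 ℬ} {C : HigherOrderCalculus Γ}
  {Q : BundleCalculus P C}

/-- For a homomorphism extending a connection, `L 1 = 1` and the result is the right side of the
connection identity; for a homotopy both summands vanish. -/
theorem tensorMapLeft_adjGen (L : Omega Γ →ₗ[ℂ] Q.Ω) (v : Γ.inv) :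
    GDSAlg.tensorMapLeft C.alg L (adjGen C v) =
      GradedTensorProduct.of ℂ Q.Ω.gr C.alg.gr
        (map (L ∘ₗ omegaIncl Γ) C.incl.toLinearMap (Γ.adj v)) +
      (L 1) ᵍ⊗ₜ[ℂ] C.inclΓ v := by
  have h : adjGen C v = GradedTensorProduct.of ℂ (Omega Γ).gr C.alg.gr
      (map (omegaIncl Γ) C.incl.toLinearMap (Γ.adj v)) + (1 : Omega Γ) ᵍ⊗ₜ[ℂ] C.inclΓ v := rfl
  rw [h, map_add, GDSAlg.tensorMapLeft_of, GDSAlg.tensorMapLeft_tmul, ← LinearMap.comp_apply,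
    ← map_comp, LinearMap.id_comp]

/-- A map killing the unit and `Γ_inv` sees only the component `dϖ(ϑ)` of `d(ϖ(ϑ) + 1 ⊗ ϑ)`. -/
theorem tensorMapLeft_tensorD_adjGen (L : Omega Γ →ₗ[ℂ] Q.Ω) (h1 : L 1 = 0)
    (h0 : ∀ v, L (omegaIncl Γ v) = 0) (v : Γ.inv) :
    GDSAlg.tensorMapLeft C.alg L (GDSAlg.tensorD _ _ (adjGen C v)) =
      GradedTensorProduct.of ℂ Q.Ω.gr C.alg.gr
        (map (L ∘ₗ (Omega Γ).d ∘ₗ omegaIncl Γ) C.incl.toLinearMap (Γ.adj v)) := by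
  have h : adjGen C v = GradedTensorProduct.of ℂ (Omega Γ).gr C.alg.gr
      (map (omegaIncl Γ) C.incl.toLinearMap (Γ.adj v)) + (1 : Omega Γ) ᵍ⊗ₜ[ℂ] C.inclΓ v := rfl
  -- Since `d 1 = 0`, the differential of `1 ⊗ ϑ` is `1 ⊗ dϑ`, which is killed because `L 1 = 0`.
  have hz : GDSAlg.tensorMapLeft C.alg L
      (GDSAlg.tensorD _ _ ((1 : Omega Γ) ᵍ⊗ₜ[ℂ] C.inclΓ v)) = 0 := by
    rw [GDSAlg.tensorD_tmul, (Omega Γ).d_one, GDSAlg.parity_one, map_add,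
      GDSAlg.tensorMapLeft_tmul, GDSAlg.tensorMapLeft_tmul, h1, map_zero]
    simp [GradedTensorProduct.tmul]
  rw [h, map_add, map_add, hz, add_zero]
  generalize Γ.adj v = t
  induction t using TensorProduct.induction_on with
  | zero => simp only [map_zero]
  | add x y h h' => simp only [map_add, h, h']
  | tmul x y =>
    rw [map_tmul, map_tmul]
    change GDSAlg.tensorMapLeft C.alg L (GDSAlg.tensorD _ _
      ((omegaIncl Γ x) ᵍ⊗ₜ[ℂ] (C.incl y))) = (L ((Omega Γ).d (omegaIncl Γ x))) ᵍ⊗ₜ[ℂ] (C.incl y)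
    have hx : omegaIncl Γ x ∈ (Omega Γ).gr 1 := omegaGen_mem Γ (Sum.inl x)
    -- The summand in which the differential hits the right factor has left factor `-x` with `x` in
    -- `Γ_inv`, so `L` kills it.
    rw [GDSAlg.tensorD_tmul, GDSAlg.parity_apply hx, map_add, GDSAlg.tensorMapLeft_tmul,
      GDSAlg.tensorMapLeft_tmul, map_smul, h0]
    simp [GradedTensorProduct.tmul]

/-! ### The extension of a connection and the homotopy between two extensions. -/

namespace Connection

variable (ω τ : Connection Q)

/-- The homomorphism of differential algebras extending a connection. -/
def extension : DGHom (Omega Γ) Q.Ω where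
  toAlgHom := omegaLiftHom ω.form
  map_d := omegaLiftHom_d ω.form_mem

theorem extension_extends : ω.ExtendsTo ω.extension := omegaLiftHom_inl ω.form

variable {ω τ}

/-- Reduces statements about an arbitrary extension to the one constructed by freeness. -/
theorem ExtendsTo.eq_extension {f : DGHom (Omega Γ) Q.Ω} (h : ω.ExtendsTo f) :
    f = ω.extension := by
  have := f.toAlgHom_eq_omegaLiftHom h
  cases f
  cases this
  rfl

variable (ω τ)

theorem extension_mem (n : ℕ) (x : Omega Γ) (hx : x ∈ (Omega Γ).gr n) :
    ω.extension x ∈ Q.Ω.gr n := omegaLiftHom_mem ω.form_mem n x hx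

/-- Both sides are multiplicative in `x` and commute with the differentials, so it suffices to
compare them on `ϑ`, where the equality is the defining identity of a connection. -/
theorem Fhat_extension (x : Omega Γ) : Q.Fhat (ω.extension x) =
    GDSAlg.tensorMapLeft C.alg ω.extension.toAlgHom.toLinearMap (adjTilde C x) := by
  have hgen : ∀ s, Q.Fhat (ω.extension (omegaGen Γ s)) =
      GDSAlg.tensorMapLeft C.alg ω.extension.toAlgHom.toLinearMap (adjTilde C (omegaGen Γ s)) := by
    have hl : ∀ v, Q.Fhat (ω.extension (omegaGen Γ (Sum.inl v))) =
        GDSAlg.tensorMapLeft C.alg ω.extension.toAlgHom.toLinearMap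
          (adjTilde C (omegaGen Γ (Sum.inl v))) := by
      intro v
      have e1 : ω.extension (omegaGen Γ (Sum.inl v)) = ω.form v := ω.extension_extends v
      have e2 : adjTilde C (omegaGen Γ (Sum.inl v)) = adjGen C v := adjTildeHom_inl C v
      have e3 : ω.extension.toAlgHom.toLinearMap ∘ₗ omegaIncl Γ = ω.form :=
        LinearMap.ext ω.extension_extends
      rw [e1, e2, tensorMapLeft_adjGen, ω.Fhat_form, e3, AlgHom.toLinearMap_apply, map_one]
    rintro (v | v)
    · exact hl v
    · rw [← omega_d_inl, ω.extension.map_d, Q.Fhat.map_d, hl, (adjTilde C).map_d,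
        GDSAlg.tensorMapLeft_tensorD ω.extension_mem ω.extension.map_d]
  refine omega_induction (p := fun x => Q.Fhat (ω.extension x) =
    GDSAlg.tensorMapLeft C.alg ω.extension.toAlgHom.toLinearMap (adjTilde C x)) ?_ ?_ ?_ ?_ ?_ x
  · simp only [map_zero]
  · rw [map_one, map_one, map_one, GDSAlg.tensorMapLeft_one]
  · intro s x h
    rw [map_mul, map_mul, map_mul, GDSAlg.tensorMapLeft_mul ω.extension_mem, hgen, h]
  · intro x y h h'; simp only [map_add, h, h']
  · intro c x h; simp only [map_smul, h]

/-- The homotopy between the extensions of two connections. -/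
def homotopy : Omega Γ →ₗ[ℂ] Q.Ω :=
  omegaTwisted ω.extension.toAlgHom τ.extension.toAlgHom (ω.form - τ.form)

theorem isHomotopy_homotopy : IsHomotopy ω τ ω.extension τ.extension (homotopy ω τ) where
  map_one := omegaTwisted_one _ _ _
  map_incl v := omegaTwisted_gen _ _ _ (Sum.inl v)
  map_d_incl v := by
    have h : (Omega Γ).d (omegaIncl Γ v) = omegaGen Γ (Sum.inr v) := omega_d_inl Γ v
    rw [h]
    exact omegaTwisted_gen _ _ _ (Sum.inr v)
  map_mul := omegaTwisted_mul _ _ _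

end Connection

/-! ### Uniqueness, the homotopy formula and covariance of `L`. -/

namespace IsHomotopy

variable {ω τ : Connection Q} {f g : DGHom (Omega Γ) Q.Ω} {L : Omega Γ →ₗ[ℂ] Q.Ω}

theorem map_gen (h : IsHomotopy ω τ f g L) (s : Γ.inv ⊕ Γ.inv) :
    L (omegaGen Γ s) = Sum.elim (fun _ => 0) (ω.form - τ.form) s := by
  rcases s with v | v
  · exact h.map_incl v
  · rw [← omega_d_inl]; exact h.map_d_incl v

/-- Absorbing the sign into `f` composed with parity removes the degree from the Leibniz rule, which
is the form that `omega_twisted_ext` compares. -/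
theorem map_gen_mul (h : IsHomotopy ω τ f g L) (s : Γ.inv ⊕ Γ.inv) (u : Omega Γ) :
    L (omegaGen Γ s * u) = L (omegaGen Γ s) * g u +
      (f.toAlgHom.toLinearMap ∘ₗ (Omega Γ).parity) (omegaGen Γ s) * L u := by
  rw [h.map_mul _ _ (omegaGen_mem Γ s), LinearMap.comp_apply,
    GDSAlg.parity_apply (omegaGen_mem Γ s), map_smul, smul_mul_assoc]
  rfl

theorem unique {L' : Omega Γ →ₗ[ℂ] Q.Ω} (h : IsHomotopy ω τ f g L)
    (h' : IsHomotopy ω τ f g L') : L' = L :=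
  LinearMap.ext (omega_twisted_ext (g := g.toAlgHom.toLinearMap)
    (h'.map_one.trans h.map_one.symm) (fun s => (h'.map_gen s).trans (h.map_gen s).symm)
    h'.map_gen_mul h.map_gen_mul)

/-- Both sides are derivations of degree zero twisted by `f` and `g`, with no sign in the Leibniz
rule. On `ϑ` only `L (dϑ)` survives, and on `dϑ` only `d (L (dϑ))`; these give `ω - τ` and its
differential. -/
theorem sub_eq (h : IsHomotopy ω τ f g L) (hf : ω.ExtendsTo f) (hg : τ.ExtendsTo g)
    (x : Omega Γ) : f x - g x = L ((Omega Γ).d x) + Q.Ω.d (L x) := by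
  have hLdeg := omega_twisted_degree (f := f.toAlgHom) (g := g.toAlgHom) (δ := ω.form - τ.form)
    (by rw [hf.eq_extension]; exact ω.extension_mem)
    (by rw [hg.eq_extension]; exact τ.extension_mem) h.map_one h.map_gen
    (fun v => sub_mem (ω.form_mem v) (τ.form_mem v)) h.map_mul
  refine omega_twisted_ext (f := f.toAlgHom.toLinearMap) (g := g.toAlgHom.toLinearMap)
    (H := f.toAlgHom.toLinearMap - g.toAlgHom.toLinearMap)
    (H' := L ∘ₗ (Omega Γ).d + Q.Ω.d ∘ₗ L) ?_ ?_ ?_ ?_ x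
  · change f 1 - g 1 = L ((Omega Γ).d 1) + Q.Ω.d (L 1)
    rw [_root_.map_one, _root_.map_one, (Omega Γ).d_one, h.map_one, map_zero, map_zero, sub_self,
      add_zero]
  · have hl : ∀ v, f (omegaGen Γ (Sum.inl v)) - g (omegaGen Γ (Sum.inl v)) =
        ω.form v - τ.form v := fun v => congrArg₂ _ (hf v) (hg v)
    intro s
    change f (omegaGen Γ s) - g (omegaGen Γ s) =
      L ((Omega Γ).d (omegaGen Γ s)) + Q.Ω.d (L (omegaGen Γ s))
    rcases s with v | v
    · rw [omega_d_inl, h.map_gen, h.map_gen, hl]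
      simp
    · rw [omega_d_inr, h.map_gen, ← omega_d_inl, f.map_d, g.map_d, ← map_sub, hl]
      simp
  · intro s u
    change f (omegaGen Γ s * u) - g (omegaGen Γ s * u) =
      (f (omegaGen Γ s) - g (omegaGen Γ s)) * g u + f (omegaGen Γ s) * (f u - g u)
    rw [_root_.map_mul, _root_.map_mul, sub_mul, mul_sub]; abel
  · intro s u
    change L ((Omega Γ).d (omegaGen Γ s * u)) + Q.Ω.d (L (omegaGen Γ s * u)) =
      (L ((Omega Γ).d (omegaGen Γ s)) + Q.Ω.d (L (omegaGen Γ s))) * g u +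
        f (omegaGen Γ s) * (L ((Omega Γ).d u) + Q.Ω.d (L u))
    have hs := omegaGen_mem Γ s
    have hfs : f (omegaGen Γ s) ∈ Q.Ω.gr (Free.wt 1 s) := by
      rw [hf.eq_extension]; exact ω.extension_mem _ _ hs
    -- Every generator has positive degree, so `L` of it has the natural degree `k`, as needed for
    -- the Leibniz rule on `L s * g u`.
    obtain ⟨k, hk⟩ : ∃ k, Free.wt 1 s = k + 1 := by rcases s with v | v <;> exact ⟨_, rfl⟩
    have hLs : L (omegaGen Γ s) ∈ Q.Ω.gr k := (hLdeg _ _ hs).2 k hk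
    rw [(Omega Γ).d_mul _ _ hs, map_add, map_smul, h.map_mul _ _ ((Omega Γ).d_mem _ _ hs),
      h.map_mul _ _ hs, h.map_mul _ _ hs, map_add, map_smul, Q.Ω.d_mul _ _ hLs,
      Q.Ω.d_mul _ _ hfs, ← g.map_d, ← f.map_d, hk]
    -- After expansion the cross terms `f (ds) * L u` and `L s * g (du)` each occur twice with
    -- opposite signs, because `L` and the differentials are odd; the squared signs of the remaining
    -- terms are one.
    have hk2 : (-1 : ℂ) ^ k * (-1) ^ k = 1 := by rw [← mul_pow]; simp
    simp only [smul_add, add_mul, mul_add, pow_succ, mul_neg, mul_one, neg_smul, smul_neg, neg_neg,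
      smul_smul, neg_mul, hk2, one_smul]
    abel

/-- Both sides are twisted derivations with values in the graded tensor product, along the
composites of `Q.Fhat` with `f` after parity and with `g`. For the right side this uses that `f` and
`g` themselves intertwine the coactions. -/
theorem Fhat_map (h : IsHomotopy ω τ f g L) (hf : ω.ExtendsTo f) (hg : τ.ExtendsTo g)
    (x : Omega Γ) : Q.Fhat (L x) = GDSAlg.tensorMapLeft C.alg L (adjTilde C x) := by
  have hfm : ∀ n, ∀ x ∈ (Omega Γ).gr n, f.toAlgHom x ∈ Q.Ω.gr n := by
    rw [hf.eq_extension]; exact ω.extension_mem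
  have hgm : ∀ n, ∀ x ∈ (Omega Γ).gr n, g.toAlgHom x ∈ Q.Ω.gr n := by
    rw [hg.eq_extension]; exact τ.extension_mem
  have hLdeg := omega_twisted_degree (f := f.toAlgHom) (g := g.toAlgHom) (δ := ω.form - τ.form)
    hfm hgm h.map_one h.map_gen (fun v => sub_mem (ω.form_mem v) (τ.form_mem v)) h.map_mul
  have hfF : ∀ x, Q.Fhat (f x) =
      GDSAlg.tensorMapLeft C.alg f.toAlgHom.toLinearMap (adjTilde C x) := by
    rw [hf.eq_extension]; exact ω.Fhat_extension
  have hgF : ∀ x, Q.Fhat (g x) =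
      GDSAlg.tensorMapLeft C.alg g.toAlgHom.toLinearMap (adjTilde C x) := by
    rw [hg.eq_extension]; exact τ.Fhat_extension
  refine omega_twisted_ext
    (f := Q.Fhat.toAlgHom.toLinearMap ∘ₗ f.toAlgHom.toLinearMap ∘ₗ (Omega Γ).parity)
    (g := Q.Fhat.toAlgHom.toLinearMap ∘ₗ g.toAlgHom.toLinearMap)
    (H := Q.Fhat.toAlgHom.toLinearMap ∘ₗ L)
    (H' := GDSAlg.tensorMapLeft C.alg L ∘ₗ (adjTilde C).toAlgHom.toLinearMap) ?_ ?_ ?_ ?_ x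
  · change Q.Fhat (L 1) = GDSAlg.tensorMapLeft C.alg L (adjTilde C 1)
    have e : adjTilde C 1 = (1 : Omega Γ) ᵍ⊗ₜ[ℂ] (1 : C.alg) := _root_.map_one (adjTildeHom C)
    rw [e, GDSAlg.tensorMapLeft_tmul, h.map_one, map_zero]
    simp [GradedTensorProduct.tmul]
  · intro s
    change Q.Fhat (L (omegaGen Γ s)) = GDSAlg.tensorMapLeft C.alg L (adjTilde C (omegaGen Γ s))
    rcases s with v | v
    -- On `ϑ` both sides vanish: `L` kills `Γ_inv` and the unit, hence both summands of `ϖ(ϑ) + 1 ⊗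
    -- ϑ`.
    · have e : adjTilde C (omegaGen Γ (Sum.inl v)) = adjGen C v := adjTildeHom_inl C v
      have e0 : L ∘ₗ omegaIncl Γ = 0 := LinearMap.ext h.map_incl
      rw [e, tensorMapLeft_adjGen, h.map_gen, h.map_one, e0]
      simp [GradedTensorProduct.tmul]
    · have e : adjTilde C (omegaGen Γ (Sum.inr v)) = GDSAlg.tensorD _ _ (adjGen C v) :=
        adjTildeHom_inr C v
      have e' : L ∘ₗ (Omega Γ).d ∘ₗ omegaIncl Γ = ω.form - τ.form := LinearMap.ext h.map_d_incl
      -- On `dϑ` the left side is the coaction of `ω(ϑ) - τ(ϑ)`. The two terms `1 ⊗ ϑ` cancel, so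
      -- the difference of connections is covariant with respect to `ϖ` alone.
      rw [e, tensorMapLeft_tensorD_adjGen L h.map_one h.map_incl, h.map_gen, e', Sum.elim_inr,
        LinearMap.sub_apply, map_sub, ω.Fhat_form, τ.Fhat_form, add_sub_add_right_eq_sub, ← map_sub]
      congr 1
      generalize Γ.adj v = t
      induction t using TensorProduct.induction_on with
      | zero => simp only [map_zero, sub_zero]
      | add x y hx hy => simp only [map_add, ← hx, ← hy]; abel
      | tmul x y => simp [sub_tmul]
  · intro s u
    change Q.Fhat (L (omegaGen Γ s * u)) = Q.Fhat (L (omegaGen Γ s)) * Q.Fhat (g u) +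
      Q.Fhat ((f.toAlgHom.toLinearMap ∘ₗ (Omega Γ).parity) (omegaGen Γ s)) * Q.Fhat (L u)
    rw [h.map_gen_mul, map_add, _root_.map_mul, _root_.map_mul]
  · intro s u
    change GDSAlg.tensorMapLeft C.alg L (adjTilde C (omegaGen Γ s * u)) =
      GDSAlg.tensorMapLeft C.alg L (adjTilde C (omegaGen Γ s)) * Q.Fhat (g u) +
      Q.Fhat (f ((Omega Γ).parity (omegaGen Γ s))) *
        GDSAlg.tensorMapLeft C.alg L (adjTilde C u)
    -- Replacing the coaction of `f` and `g` by `f ⊗ id` and `g ⊗ id` after `adjTilde C` leaves the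
    -- twisted Leibniz rule of `L ⊗ id`, applied to a left factor of total degree `Free.wt 1 s`.
    rw [_root_.map_mul, GDSAlg.parity_apply (omegaGen_mem Γ s), map_smul, map_smul, hgF, hfF,
      smul_mul_assoc]
    exact GDSAlg.tensorMapLeft_twisted hgm h.map_mul (fun x hx => (hLdeg 0 x hx).1 rfl)
      (fun n x hx => (hLdeg (n + 1) x hx).2 n rfl) ((adjTilde C).map_mem _ _ (omegaGen_mem Γ s)) _

end IsHomotopy

end Bundle

end

end QPB

/-! ### The Weil homomorphism and its independence of the connection. -/

theorem mainTheorem2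
    {𝒜 : Type u} [Ring 𝒜] [StarRing 𝒜] [HopfAlgebra ℂ 𝒜] [StarModule ℂ 𝒜]
    [CompactMatrixQuantumGroup 𝒜]
    {𝒱 : Type v} [Ring 𝒱] [StarRing 𝒱] [Algebra ℂ 𝒱] [StarModule ℂ 𝒱]
    {ℬ : Type w} [Ring ℬ] [StarRing ℬ] [Algebra ℂ ℬ] [StarModule ℂ ℬ]
    (Γ : BicovariantCalculus 𝒜) (C : HigherOrderCalculus Γ)
    (P : QuantumPrincipalBundle 𝒜 𝒱 ℬ) (Q : BundleCalculus P C) :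
    (∀ ω : Connection Q, ∃ f : DGHom (Omega Γ) Q.Ω,
      (ω.ExtendsTo f ∧ ∀ f' : DGHom (Omega Γ) Q.Ω, ω.ExtendsTo f' → f' = f) ∧
      (∀ n, ∀ x ∈ (Omega Γ).gr n, f x ∈ Q.Ω.gr n) ∧
      (∀ x, f ((Omega Γ).st x) = Q.Ω.st (f x)) ∧
      (∀ x, Q.Fhat (f x) =
        GDSAlg.tensorMapLeft C.alg f.toAlgHom.toLinearMap (adjTilde C x)) ∧
      (∀ x ∈ daleth C, f x ∈ Q.baseForms)) ∧
    (∀ (ω τ : Connection Q) (f g : DGHom (Omega Γ) Q.Ω), ω.ExtendsTo f → τ.ExtendsTo g →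
      (∀ (hf : ∀ x ∈ daleth C, f x ∈ Q.baseForms) (hg : ∀ x ∈ daleth C, g x ∈ Q.baseForms),
        DGSub.cohomologyMap f hf = DGSub.cohomologyMap g hg) ∧
      (∃ L : Omega Γ →ₗ[ℂ] Q.Ω,
        (IsHomotopy ω τ f g L ∧ ∀ L', IsHomotopy ω τ f g L' → L' = L) ∧
        (∀ x, f x - g x = L ((Omega Γ).d x) + Q.Ω.d (L x)) ∧
        (∀ x, Q.Fhat (L x) = GDSAlg.tensorMapLeft C.alg L (adjTilde C x)) ∧
        (∀ x ∈ daleth C, L x ∈ Q.baseForms))) := by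
  refine ⟨fun ω => ⟨ω.extension, ⟨ω.extension_extends, fun f' h => h.eq_extension⟩,
    ω.extension_mem, omegaLiftHom_st ω.form_mem ω.form_st, ω.Fhat_extension, fun x hx =>
      DGCoaction.mem_invariants_of_intertwines (f := ω.extension.toAlgHom.toLinearMap)
        ω.Fhat_extension hx⟩, ?_⟩
  intro ω τ f g hf hg
  have h : IsHomotopy ω τ f g (Connection.homotopy ω τ) := by
    rw [hf.eq_extension, hg.eq_extension]; exact Connection.isHomotopy_homotopy ω τ
  -- The criterion for preserving coinvariants needs only a linear intertwiner, so it applies to `L`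
  -- although `L` is not multiplicative. This places the primitives supplied by the homotopy among
  -- the base forms.
  have hinv : ∀ x ∈ daleth C, Connection.homotopy ω τ x ∈ Q.baseForms := fun x hx =>
    DGCoaction.mem_invariants_of_intertwines (h.Fhat_map hf hg) hx
  exact ⟨fun hfK hgK => DGSub.cohomologyMap_eq_of_homotopy hfK hgK _ (h.sub_eq hf hg) hinv,
    _, ⟨h, fun L' h' => h.unique h'⟩, h.sub_eq hf hg, h.Fhat_map hf hg, hinv⟩
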